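/- Let $k$ be a commutative ring and let $\mathfrak{C}$ be a small skeletal $k$-linear category. Let $d:\mathrm{Ob}(\mathfrak{C})\to\lambda$ be a function to an ordinal, and let $\mathfrak{C}^+,\mathfrak{C}^-$ be two $k$-linear subcategories of $\mathfrak{C}$ with the same objects as $\mathfrak{C}$. Put $\mathfrak{C}^0=\mathfrak{C}^+\cap\mathfrak{C}^-$ and $A_x^0=\mathfrak{C}^0(x,x)$. Assume that these data form a generalized $k$-linear Reedy category, that is: (a) $\mathfrak{C}^+(x,y)\neq 0$ only if $x=y$ or $d(x)<d(y)$; (b) $\mathfrak{C}^-(x,y)\neq 0$ only if $x=y$ or $d(x)>d(y)$; (c) $\mathfrak{C}^+(x,x)=\mathfrak{C}^-(x,x)$ for all $x$; (d) for all $x,y$ the map $\bigoplus_{z}\mathfrak{C}^+(z,y)\otimes_{A_z^0}\mathfrak{C}^-(x,z)\to\mathfrak{C}(x,y)$ induced by composition is bijective. Suppose that $\mathfrak{C}^+$ is a projective right $\mathfrak{C}^0$-module, that $\mathfrak{C}^-$ is a projective left $\mathfrak{C}^0$-module, and that every ring $A_x^0$ is semi-perfect. A $\mathfrak{C}$-module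 is a $k$-linear functor from $\mathfrak{C}$ to $k$-modules. For $\alpha\in\lambda$ let $\mathfrak{I}_\alpha(x,y)\subseteq\mathfrak{C}(x,y)$ be the image under composition of $\bigoplus_{d(z)<\alpha}\mathfrak{C}^+(z,y)\otimes_{A_z^0}\mathfrak{C}^-(x,z)$, and for an idempotent $e\in A_x^0$ let $\Delta_{x,e}$ be the $\mathfrak{C}$-module $y\mapsto \mathfrak{C}(x,y)e/\mathfrak{I}_{d(x)}(x,y)e$. Then each $A_x^0$ has a finite complete set of orthogonal primitive idempotents. For every choice of such a set $E_x$ for each object $x$, the modules $\Delta_{x,e}$ with $e\in E_x$ are indecomposable, and there are bijections between the following sets: 1. the set of isomorphism classes of simple $\mathfrak{C}$-modules; 2. the set of isomorphism classes of the modules $\Delta_{x,e}$ with $x\in\mathrm{Ob}(\mathfrak{C})$ and $e\in E_x$; 3. $\bigsqcup_{x\in\mathrm{Ob}(\mathfrak{C})}E_x/{\sim}$, where $e\sim e'$ if and only if $A_x^0e\cong A_x^0e'$ as left $A_x^0$-modules; 4. $\bigsqcup_{x\in\mathrm{Ob}(\mathfrak{C})}\{\text{isomorphism classes of simple left }A_x^0\text{-modules}\}$.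 These bijections can be chosen such that the class of $\Delta_{x,e}$ corresponds in (1) to the class of the unique simple quotient of $\Delta_{x,e}$, in (3) to the class of $e\in E_x$, and in (4) to the class of the unique simple quotient of $A_x^0e$. -/

import Mathlib

open CategoryTheory
open scoped TensorProduct DirectSum

universe t u v w

noncomputable section

/-! ### Rings -/

/-- A (not necessarily commutative) ring `A` is semi-perfect if `A / J(A)` is semisimple and
idempotents lift modulo the Jacobson radical `J(A)`. -/
def IsSemiperfectRing (A : Type*) [Ring A] : Prop :=
  IsSemisimpleRing (A ⧸ Ring.jacobson A) ∧
    ∀ a : A, a * a - a ∈ Ring.jacobson A →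
      ∃ e : A, IsIdempotentElem e ∧ e - a ∈ Ring.jacobson A

/-- Primitive idempotents: nonzero, and not a sum of two nonzero orthogonal idempotents. -/
def IsPrimitiveIdempotent {A : Type*} [Ring A] (e : A) : Prop :=
  IsIdempotentElem e ∧ e ≠ 0 ∧
    ∀ f g : A, IsIdempotentElem f → IsIdempotentElem g → f * g = 0 → g * f = 0 → e = f + g →
      f = 0 ∨ g = 0

/-- A finite complete set of orthogonal primitive idempotents (with sum `1`). -/
def IsCompletePrimitiveSet {A : Type*} [Ring A] (E : Finset A) : Prop :=
  CompleteOrthogonalIdempotents (fun e : E => (e : A)) ∧ ∀ e ∈ E, IsPrimitiveIdempotent e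

/-- Isomorphism of the left ideals `A e` and `A e'` as left `A`-modules. -/
def idempotentSetoid {A : Type*} [Ring A] (E : Finset A) : Setoid E where
  r e e' := Nonempty ((Ideal.span {(e : A)} : Ideal A) ≃ₗ[A] (Ideal.span {(e' : A)} : Ideal A))
  iseqv :=
    ⟨fun _ => ⟨LinearEquiv.refl _ _⟩, fun ⟨h⟩ => ⟨h.symm⟩, fun ⟨h⟩ ⟨h'⟩ => ⟨h.trans h'⟩⟩

/-- Isomorphism of left modules which are simple. -/
def simpleModuleSetoid (A : Type v) [Ring A] :
    Setoid {L : ModuleCat.{v} A // IsSimpleModule A L} where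
  r L L' := Nonempty (L.1 ≃ₗ[A] L'.1)
  iseqv :=
    ⟨fun _ => ⟨LinearEquiv.refl _ _⟩, fun ⟨h⟩ => ⟨h.symm⟩, fun ⟨h⟩ ⟨h'⟩ => ⟨h.trans h'⟩⟩

/-- The isomorphism classes of simple left `A`-modules. -/
def SimpleModuleClass (A : Type v) [Ring A] := Quotient (simpleModuleSetoid A)

/-- The tensor product `M ⊗_A N` of a right module `M` and a left module `N` over a possibly
noncommutative `k`-algebra `A`, as the quotient of `M ⊗_k N` by the relations
`m a ⊗ n = m ⊗ a n`. -/
abbrev BalancedTensor (k : Type*) [CommRing k] (A : Type*) [Ring A]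
    (M N : Type*) [AddCommGroup M] [AddCommGroup N] [Module k M] [Module k N]
    [Module Aᵐᵒᵖ M] [Module A N] :=
  (M ⊗[k] N) ⧸ Submodule.span k
    {s : M ⊗[k] N | ∃ (m : M) (a : A) (n : N),
      s = (MulOpposite.op a • m) ⊗ₜ[k] n - m ⊗ₜ[k] (a • n)}

/-! ### Linear subcategories with all objects -/

/-- A `k`-linear subcategory of `C` with the same objects as `C`. -/
structure LinSubcat (k : Type w) [CommRing k] (C : Type u) [Category.{v} C] [Preadditive C]
    [Linear k C] where
  hom : ∀ x y : C, Submodule k (x ⟶ y)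
  id_mem : ∀ x : C, 𝟙 x ∈ hom x x
  comp_mem : ∀ {x y z : C} {f : x ⟶ y} {g : y ⟶ z},
    f ∈ hom x y → g ∈ hom y z → f ≫ g ∈ hom x z

namespace LinSubcat

variable {k : Type w} [CommRing k] {C : Type u} [Category.{v} C] [Preadditive C] [Linear k C]

/-- The intersection of two linear subcategories. -/
def inter (P Q : LinSubcat k C) : LinSubcat k C where
  hom x y := P.hom x y ⊓ Q.hom x y
  id_mem x := ⟨P.id_mem x, Q.id_mem x⟩
  comp_mem hf hg := ⟨P.comp_mem hf.1 hg.1, Q.comp_mem hf.2 hg.2⟩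

/-- The endomorphism algebra of `x` in a linear subcategory; the product `a * b` is the composite
"first `b`, then `a`". -/
def endAlg (S : LinSubcat k C) (x : C) : Subalgebra k (End x) where
  carrier := {a : End x | (a : x ⟶ x) ∈ S.hom x x}
  mul_mem' {_ _} ha hb := S.comp_mem hb ha
  one_mem' := S.id_mem x
  add_mem' {_ _} ha hb := (S.hom x x).add_mem ha hb
  zero_mem' := (S.hom x x).zero_mem
  algebraMap_mem' r := (S.hom x x).smul_mem r (S.id_mem x)

/-- `P(x, y)` is a right module over `(P ∩ Q)(x, x)`, by precomposition. -/
instance rightModule (P Q : LinSubcat k C) (x y : C) :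
    Module ((P.inter Q).endAlg x)ᵐᵒᵖ (P.hom x y) where
  smul a g := ⟨(a.unop.1 : x ⟶ x) ≫ g.1, P.comp_mem a.unop.2.1 g.2⟩
  one_smul g := Subtype.ext (Category.id_comp g.1)
  mul_smul a b g := Subtype.ext
    (Category.assoc (a.unop.1 : x ⟶ x) (b.unop.1 : x ⟶ x) g.1)
  smul_zero _ := Subtype.ext Limits.comp_zero
  smul_add _ _ _ := Subtype.ext (Preadditive.comp_add _ _ _ _ _ _)
  add_smul _ _ _ := Subtype.ext (Preadditive.add_comp _ _ _ _ _ _)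
  zero_smul _ := Subtype.ext Limits.zero_comp

/-- `Q(x, y)` is a left module over `(P ∩ Q)(y, y)`, by postcomposition. -/
instance leftModule (P Q : LinSubcat k C) (x y : C) :
    Module ((P.inter Q).endAlg y) (Q.hom x y) where
  smul a f := ⟨f.1 ≫ (a.1 : y ⟶ y), Q.comp_mem f.2 a.2.2⟩
  one_smul f := Subtype.ext (Category.comp_id f.1)
  mul_smul _ _ _ := Subtype.ext (Category.assoc _ _ _).symm
  smul_zero _ := Subtype.ext Limits.zero_comp
  smul_add _ _ _ := Subtype.ext (Preadditive.add_comp _ _ _ _ _ _)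
  add_smul _ _ _ := Subtype.ext (Preadditive.comp_add _ _ _ _ _ _)
  zero_smul _ := Subtype.ext Limits.comp_zero

/-- Composition `P(z, y) ⊗ Q(x, z) → C(x, y)`, `g ⊗ f ↦ g f`, over `(P ∩ Q)(z, z)`. -/
def compTensor (P Q : LinSubcat k C) (x z y : C) :
    BalancedTensor k ((P.inter Q).endAlg z) (P.hom z y) (Q.hom x z) →ₗ[k] (x ⟶ y) :=
  Submodule.liftQ _
    (TensorProduct.lift
      (((Linear.comp (S := k) x z y).flip.compl₂ (Q.hom x z).subtype).comp (P.hom z y).subtype))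
    (by
      rw [Submodule.span_le]
      rintro _ ⟨g, a, f, rfl⟩
      rw [SetLike.mem_coe, LinearMap.mem_ker, map_sub, sub_eq_zero]
      exact (Category.assoc f.1 (a.1 : z ⟶ z) g.1).symm)

open Classical in
/-- The map `⨁_z P(z, y) ⊗ Q(x, z) → C(x, y)` induced by composition. -/
def compSum (P Q : LinSubcat k C) (x y : C) :
    (⨁ z : C, BalancedTensor k ((P.inter Q).endAlg z) (P.hom z y) (Q.hom x z)) →ₗ[k] (x ⟶ y) :=
  DirectSum.toModule k C (x ⟶ y) (fun z => compTensor P Q x z y)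

end LinSubcat

/-! ### Representations -/

/-- A representation of `C` (a left `C`-module): a `k`-linear functor from `C` to `k`-modules. -/
structure LinRep (k : Type w) [CommRing k] (C : Type u) [Category.{v} C] [Preadditive C]
    [Linear k C] where
  toFunctor : C ⥤ ModuleCat.{v} k
  additive : toFunctor.Additive
  linear : toFunctor.Linear k

namespace LinRep

variable {k : Type w} [CommRing k] {C : Type u} [Category.{v} C] [Preadditive C] [Linear k C]

/-- A subrepresentation. -/
structure Subrep (M : LinRep k C) where
  carrier : ∀ x : C, Submodule k (M.toFunctor.obj x)
  map_mem : ∀ {x y : C} (f : x ⟶ y) {m : M.toFunctor.obj x},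
    m ∈ carrier x → (M.toFunctor.map f).hom m ∈ carrier y

/-- Nonzero representations. -/
def IsNonzero (M : LinRep k C) : Prop := ∃ x : C, Nontrivial (M.toFunctor.obj x)

/-- Irreducible (simple) representations: nonzero, with no subrepresentation except zero and the
whole representation. -/
def IsIrreducible (M : LinRep k C) : Prop :=
  M.IsNonzero ∧ ∀ N : M.Subrep, (∀ x, N.carrier x = ⊥) ∨ (∀ x, N.carrier x = ⊤)

/-- Indecomposable representations: nonzero, and not the direct sum of two nonzero
subrepresentations. -/
def IsIndecomposable (M : LinRep k C) : Prop :=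
  M.IsNonzero ∧ ∀ N N' : M.Subrep, (∀ x, IsCompl (N.carrier x) (N'.carrier x)) →
    (∀ x, N.carrier x = ⊥) ∨ (∀ x, N'.carrier x = ⊥)

/-- `S` is a quotient of `M`: there is a morphism `M → S` which is surjective on each object. -/
def HasQuotient (M S : LinRep k C) : Prop :=
  ∃ f : M.toFunctor ⟶ S.toFunctor, ∀ x : C, Function.Surjective (f.app x).hom

/-- Isomorphism of representations. -/
instance isoSetoid (k : Type w) [CommRing k] (C : Type u) [Category.{v} C] [Preadditive C]
    [Linear k C] : Setoid (LinRep k C) where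
  r M N := Nonempty (M.toFunctor ≅ N.toFunctor)
  iseqv := ⟨fun _ => ⟨Iso.refl _⟩, fun ⟨h⟩ => ⟨h.symm⟩, fun ⟨h⟩ ⟨h'⟩ => ⟨h.trans h'⟩⟩

/-- Isomorphism classes of representations. -/
abbrev IsoClass (k : Type w) [CommRing k] (C : Type u) [Category.{v} C] [Preadditive C]
    [Linear k C] := Quotient (isoSetoid k C)

/-- The isomorphism class `[M]`. -/
def cls (M : LinRep k C) : IsoClass k C := Quotient.mk _ M

/-- The set of isomorphism classes of irreducible representations. -/
def irreducibleClasses (k : Type w) [CommRing k] (C : Type u) [Category.{v} C] [Preadditive C]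
    [Linear k C] : Set (IsoClass k C) :=
  {c | ∃ S : LinRep k C, S.IsIrreducible ∧ c = S.cls}

end LinRep

/-! ### Generalized linear Reedy categories -/

/-- A generalized `k`-linear Reedy structure on a skeletal `k`-linear category `C`. -/
structure GenReedy (k : Type w) [CommRing k] (C : Type u) [Category.{v} C] [Preadditive C]
    [Linear k C] where
  skeletal : Skeletal C
  lam : Ordinal.{t}
  deg : C → Set.Iio lam
  plus : LinSubcat k C
  minus : LinSubcat k C
  plus_deg : ∀ x y : C, plus.hom x y ≠ ⊥ → x = y ∨ deg x < deg y
  minus_deg : ∀ x y : C, minus.hom x y ≠ ⊥ → x = y ∨ deg y < deg x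
  diag : ∀ x : C, plus.hom x x = minus.hom x x
  comp_bijective : ∀ x y : C, Function.Bijective (LinSubcat.compSum plus minus x y)

namespace GenReedy

variable {k : Type w} [CommRing k] {C : Type u} [Category.{v} C] [Preadditive C] [Linear k C]

/-- The algebra `A_x^0 = C⁰(x, x)`, where `C⁰ = C⁺ ∩ C⁻`. -/
abbrev A0 (R : GenReedy.{t} k C) (x : C) : Subalgebra k (End x) :=
  (R.plus.inter R.minus).endAlg x

/-- `C⁺` is a projective right `C⁰`-module. Since `C⁰` is the coproduct of the algebras `A_x^0`, a
right `C⁰`-module is a family of right `A_x^0`-modules; for `C⁺` the member of this family at `x`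
is `C⁺ 1_x = ⨁_y C⁺(x, y)`. -/
def PlusRightProjective (R : GenReedy.{t} k C) : Prop :=
  ∀ x : C, Module.Projective (R.A0 x)ᵐᵒᵖ (⨁ y : C, R.plus.hom x y)

/-- `C⁻` is a projective left `C⁰`-module. As a left `C⁰`-module, `C⁻` is the family of the left
`A_y^0`-modules `1_y C⁻ = ⨁_x C⁻(x, y)`. -/
def MinusLeftProjective (R : GenReedy.{t} k C) : Prop :=
  ∀ y : C, Module.Projective (R.A0 y) (⨁ x : C, R.minus.hom x y)

/-- The ideal `I_α`: `I_α(x, y)` is the image in `C(x, y)` of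
`⨁_{d(z) < α} C⁺(z, y) ⊗ C⁻(x, z)` under composition. -/
def ideal (R : GenReedy.{t} k C) (α : Set.Iio R.lam) (x y : C) : Submodule k (x ⟶ y) :=
  Submodule.span k {h : x ⟶ y | ∃ (z : C) (f : x ⟶ z) (g : z ⟶ y),
    R.deg z < α ∧ f ∈ R.minus.hom x z ∧ g ∈ R.plus.hom z y ∧ h = f ≫ g}

open Classical in
lemma compSum_of (R : GenReedy.{t} k C) (x y z : C)
    (s : BalancedTensor k (R.A0 z) (R.plus.hom z y) (R.minus.hom x z)) :
    LinSubcat.compSum R.plus R.minus x y (DirectSum.of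
      (fun z : C => BalancedTensor k (R.A0 z) (R.plus.hom z y) (R.minus.hom x z)) z s) =
    LinSubcat.compTensor R.plus R.minus x z y s :=
  DirectSum.toModule_lof (M := fun z : C =>
    BalancedTensor k (R.A0 z) (R.plus.hom z y) (R.minus.hom x z)) k z s

lemma mem_span_comp (R : GenReedy.{t} k C) {x y : C} (h : x ⟶ y) :
    h ∈ Submodule.span k {h : x ⟶ y | ∃ (z : C) (f : x ⟶ z) (g : z ⟶ y),
      f ∈ R.minus.hom x z ∧ g ∈ R.plus.hom z y ∧ h = f ≫ g} := by
  classical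
  obtain ⟨s, rfl⟩ := (R.comp_bijective x y).2 h
  induction s using DirectSum.induction_on with
  | zero => simp
  | add a b ha hb => rw [map_add]; exact Submodule.add_mem _ ha hb
  | of z s =>
    rw [show LinSubcat.compSum R.plus R.minus x y (DirectSum.of _ z s) =
        LinSubcat.compTensor R.plus R.minus x z y s from R.compSum_of x y z s]
    obtain ⟨s, rfl⟩ := Submodule.Quotient.mk_surjective _ s
    induction s using TensorProduct.induction_on with
    | zero => simp
    | add a b ha hb =>
      rw [Submodule.Quotient.mk_add, map_add]
      exact Submodule.add_mem _ ha hb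
    | tmul g f => exact Submodule.subset_span ⟨z, f.1, g.1, f.2, g.2, rfl⟩

lemma ideal_comp_mem (R : GenReedy.{t} k C) (α : Set.Iio R.lam) {x y y' : C} {h : x ⟶ y}
    (hh : h ∈ R.ideal α x y) (l : y ⟶ y') : h ≫ l ∈ R.ideal α x y' := by
  induction hh using Submodule.span_induction with
  | zero => simp
  | add a b _ _ ha hb => rw [Preadditive.add_comp]; exact Submodule.add_mem _ ha hb
  | smul r a _ ha => rw [Linear.smul_comp]; exact Submodule.smul_mem _ r ha
  | mem h hh =>
    obtain ⟨z, f, g, hz, hf, -, rfl⟩ := hh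
    rw [Category.assoc]
    have hm := R.mem_span_comp (g ≫ l)
    generalize g ≫ l = m at hm
    induction hm using Submodule.span_induction with
    | zero => simp
    | add a b _ _ ha hb => rw [Preadditive.comp_add]; exact Submodule.add_mem _ ha hb
    | smul r a _ ha => rw [Linear.comp_smul]; exact Submodule.smul_mem _ r ha
    | mem m hm =>
      obtain ⟨z', f', g', hf', hg', rfl⟩ := hm
      by_cases h0 : R.minus.hom z z' = ⊥
      · rw [h0, Submodule.mem_bot] at hf'
        simp [hf']
      · refine Submodule.subset_span ⟨z', f ≫ f', g', ?_, R.minus.comp_mem hf hf', hg', by simp⟩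
        rcases R.minus_deg z z' h0 with rfl | hlt
        · exact hz
        · exact hlt.trans hz

/-- `(C e)(y) = C(x, y) e`, a subspace of `C(x, y)`, for an endomorphism `e` of `x`. -/
def principal {x : C} (e : x ⟶ x) (y : C) : Submodule k (x ⟶ y) :=
  LinearMap.range (Linear.leftComp k y e)

/-- `(I_α e)(y) = I_α(x, y) e` where `α = d(x)`. -/
def idealMul (R : GenReedy.{t} k C) {x : C} (e : x ⟶ x) (y : C) : Submodule k (x ⟶ y) :=
  (R.ideal (R.deg x) x y).map (Linear.leftComp k y e)

/-- Postcomposition with `f`, as a map `C e → C e`. -/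
def principalMap {x : C} (e : x ⟶ x) {y y' : C} (f : y ⟶ y') :
    principal (k := k) e y →ₗ[k] principal (k := k) e y' :=
  (Linear.rightComp k x f).restrict (by
    rintro _ ⟨g, rfl⟩
    exact ⟨g ≫ f, (Category.assoc e g f).symm⟩)

/-- The map induced by `principalMap` on the quotients by `I_α e`. -/
def standardMap (R : GenReedy.{t} k C) {x : C} (e : x ⟶ x) {y y' : C} (f : y ⟶ y') :
    (principal (k := k) e y ⧸ (R.idealMul e y).submoduleOf (principal e y)) →ₗ[k]
      (principal (k := k) e y' ⧸ (R.idealMul e y').submoduleOf (principal e y')) :=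
  Submodule.mapQ _ _ (principalMap e f) (by
    rintro ⟨_, _⟩ ⟨g, hg, rfl⟩
    exact ⟨g ≫ f, R.ideal_comp_mem _ hg f, (Category.assoc e g f).symm⟩)

lemma standardMap_id (R : GenReedy.{t} k C) {x : C} (e : x ⟶ x) (y : C) :
    R.standardMap e (𝟙 y) = LinearMap.id := by
  refine Submodule.linearMap_qext _ (LinearMap.ext fun m => ?_)
  exact congrArg (Submodule.Quotient.mk (p := (R.idealMul e y).submoduleOf _))
    (Subtype.ext (Category.comp_id m.1))

lemma standardMap_comp (R : GenReedy.{t} k C) {x : C} (e : x ⟶ x) {y y' y'' : C} (f : y ⟶ y')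
    (g : y' ⟶ y'') : R.standardMap e (f ≫ g) = (R.standardMap e g).comp (R.standardMap e f) := by
  refine Submodule.linearMap_qext _ (LinearMap.ext fun m => ?_)
  exact congrArg (Submodule.Quotient.mk (p := (R.idealMul e y'').submoduleOf _))
    (Subtype.ext (Category.assoc m.1 f g).symm)

lemma standardMap_add (R : GenReedy.{t} k C) {x : C} (e : x ⟶ x) {y y' : C} (f g : y ⟶ y') :
    R.standardMap e (f + g) = R.standardMap e f + R.standardMap e g := by
  refine Submodule.linearMap_qext _ (LinearMap.ext fun m => ?_)
  exact congrArg (Submodule.Quotient.mk (p := (R.idealMul e y').submoduleOf _))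
    (Subtype.ext (Preadditive.comp_add _ _ _ m.1 f g))

lemma standardMap_smul (R : GenReedy.{t} k C) {x : C} (e : x ⟶ x) {y y' : C} (r : k)
    (f : y ⟶ y') : R.standardMap e (r • f) = r • R.standardMap e f := by
  refine Submodule.linearMap_qext _ (LinearMap.ext fun m => ?_)
  exact congrArg (Submodule.Quotient.mk (p := (R.idealMul e y').submoduleOf _))
    (Subtype.ext (Linear.comp_smul _ _ _ m.1 r f))

/-- The standard module `Δ_{x,e} = C e / I_α e`, where `α = d(x)`. -/
def standard (R : GenReedy.{t} k C) (x : C) (e : R.A0 x) : LinRep k C where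
  toFunctor :=
    { obj := fun y => ModuleCat.of k
        (principal (k := k) (e.1 : x ⟶ x) y ⧸
          (R.idealMul (e.1 : x ⟶ x) y).submoduleOf (principal (e.1 : x ⟶ x) y))
      map := fun f => ModuleCat.ofHom (R.standardMap (e.1 : x ⟶ x) f)
      map_id := fun y => ModuleCat.hom_ext (R.standardMap_id _ y)
      map_comp := fun f g => ModuleCat.hom_ext (R.standardMap_comp _ f g) }
  additive := ⟨fun {_ _ f g} => ModuleCat.hom_ext (R.standardMap_add _ f g)⟩
  linear := ⟨fun f r => ModuleCat.hom_ext (R.standardMap_smul _ r f)⟩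

/-- The set of isomorphism classes of the standard modules `Δ_{x,e}` with `e ∈ E_x`. -/
def standardClasses (R : GenReedy.{t} k C) (E : ∀ x : C, Finset (R.A0 x)) :
    Set (LinRep.IsoClass k C) :=
  {c | ∃ (x : C) (e : R.A0 x), e ∈ E x ∧ c = (R.standard x e).cls}

end GenReedy

end

noncomputable section

/-! ### Idempotents of semi-perfect rings -/

section Rings

variable {A : Type*} [Ring A]

/-! Bijectivity of composition gives `C(x, x) = A_x^0 ⊕ I_{d(x)}(x, x)`
(`exists_endAlg_sub_mem_ideal`, `eq_zero_of_mem_ideal`). On a module `M` that vanishes in degrees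
below `d(x)` the ideal acts by zero on `M(x)`, so endomorphisms of `x` act there through `A_x^0`.
Among such modules `Δ_{x,e}` represents `M ↦ e M(x)` (`exists_hom_standard`), and `Δ_{x,e}(x)` is a
copy of `A_x^0 e`.

For primitive `e` over a semi-perfect ring, `A_x^0 e` is local
(`IsPrimitiveIdempotent.mem_of_not_le`). A proper submodule of `Δ_{x,e}` omits the generator, so its
value at `x` lies in the radical of `A_x^0 e`. Hence there is a largest proper submodule
(`le_standardRad`), which yields both indecomposability and a unique simple quotient.

Conversely, for simple `S` take `x` of minimal degree with `S(x) ≠ 0` and `e ∈ E_x` with `e S(x) ≠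
0`; then `Δ_{x,e}` maps onto `S`. The support of `S` determines `x`, and
`IsPrimitiveIdempotent.idempotentEquiv` determines `e` up to equivalence. Thus all four sets are
quotients of `⨆ E_x` (disjoint union) by one relation, `SigmaEquiv`, and
`exists_equiv_of_surjective` matches them. -/

lemma exists_mul_eq_one_of_sub_one_mem_jacobson {r : A} (h : r - 1 ∈ Ring.jacobson A) :
    ∃ s : A, s * r = 1 := by
  rw [← Ideal.jacobson_bot] at h
  obtain ⟨s, hs⟩ := Ideal.exists_mul_sub_mem_of_sub_one_mem_jacobson r h
  exact ⟨s, sub_eq_zero.1 (by simpa using hs)⟩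

/-- A left inverse of `r` is again congruent to `1` modulo the radical, so it has a left inverse
too, which must be `r`. -/
lemma isUnit_of_sub_one_mem_ringJacobson {r : A} (h : r - 1 ∈ Ring.jacobson A) : IsUnit r := by
  obtain ⟨s, hs⟩ := exists_mul_eq_one_of_sub_one_mem_jacobson h
  have hs' : s - 1 ∈ Ring.jacobson A := by
    have : s - 1 = -(s * (r - 1)) := by rw [mul_sub, hs]; simp
    rw [this]
    exact neg_mem (Ideal.mul_mem_left _ _ h)
  obtain ⟨q, hq⟩ := exists_mul_eq_one_of_sub_one_mem_jacobson hs'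
  have : q = r := by rw [← mul_one q, ← hs, ← mul_assoc, hq, one_mul]
  subst this
  exact ⟨⟨q, s, hq, hs⟩, rfl⟩

lemma IsIdempotentElem.eq_zero_of_mem_jacobson {e : A} (he : IsIdempotentElem e)
    (h : e ∈ Ring.jacobson A) : e = 0 := by
  obtain ⟨s, hs⟩ := exists_mul_eq_one_of_sub_one_mem_jacobson (r := 1 - e) (by simpa using h)
  have h0 : (1 - e) * e = 0 := by rw [sub_mul, one_mul, he.eq, sub_self]
  rw [← one_mul e, ← hs, mul_assoc, h0, mul_zero]

/-- An element of a module which is fixed by the Jacobson radical is zero. -/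
lemma eq_zero_of_mem_jacobson_smul {M : Type*} [AddCommGroup M] [Module A M] {j : A}
    (hj : j ∈ Ring.jacobson A) {m : M} (h : j • m = m) : m = 0 := by
  obtain ⟨s, hs⟩ := exists_mul_eq_one_of_sub_one_mem_jacobson (r := 1 - j) (by simpa using hj)
  rw [← one_smul A m, ← hs, mul_smul, sub_smul, one_smul, h, sub_self, smul_zero]

lemma mul_right_eq_self_of_mem_span {e a : A} (he : IsIdempotentElem e)
    (ha : a ∈ Ideal.span {e}) : a * e = a := by
  obtain ⟨b, rfl⟩ := Ideal.mem_span_singleton'.1 ha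
  rw [mul_assoc, he.eq]

/-- In a semi-perfect ring, a left ideal which is not contained in the Jacobson radical contains
a nonzero idempotent. -/
lemma IsSemiperfectRing.exists_idempotent_mem (hA : IsSemiperfectRing A) {N : Ideal A}
    (hN : ¬ N ≤ Ring.jacobson A) : ∃ g ∈ N, IsIdempotentElem g ∧ g ≠ 0 := by
  obtain ⟨hss, hlift⟩ := hA
  obtain ⟨u, hu, hspan⟩ := IsSemisimpleRing.ideal_eq_span_idempotent
    (N.map (Ideal.Quotient.mk (Ring.jacobson A)))
  have hmem : u ∈ N.map (Ideal.Quotient.mk (Ring.jacobson A)) := by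
    rw [hspan]; exact Ideal.mem_span_singleton_self u
  obtain ⟨n, hnN, rfl⟩ :=
    (Ideal.mem_map_iff_of_surjective _ Ideal.Quotient.mk_surjective).1 hmem
  have hn0 : n ∉ Ring.jacobson A := by
    intro hn
    apply hN
    intro m hm
    have := Ideal.mem_map_of_mem (Ideal.Quotient.mk (Ring.jacobson A)) hm
    rw [hspan, Ideal.Quotient.eq_zero_iff_mem.2 hn] at this
    exact Ideal.Quotient.eq_zero_iff_mem.1 (by simpa using this)
  have hnn : n * n - n ∈ Ring.jacobson A := by
    rw [← Ideal.Quotient.eq_zero_iff_mem, map_sub, map_mul, hu.eq, sub_self]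
  obtain ⟨h, hh, hhn⟩ := hlift n hnn
  -- The lift `h` need not lie in `N`. Since `U = 1 - h + n` is a unit with `h U = h n`, the
  -- conjugate `U⁻¹ h U = U⁻¹ h n` is an idempotent that does.
  obtain ⟨U, hU⟩ : IsUnit (1 - h + n) := isUnit_of_sub_one_mem_ringJacobson (by
    have : 1 - h + n - 1 = -(h - n) := by abel
    rw [this]; exact neg_mem hhn)
  have hUn : h * U = h * n := by
    rw [hU, mul_add, mul_sub, mul_one, hh.eq, sub_self, zero_add]
  have hg : ((U⁻¹ : Aˣ) : A) * h * n = ((U⁻¹ : Aˣ) : A) * h * U := by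
    rw [mul_assoc, mul_assoc, hUn]
  refine ⟨((U⁻¹ : Aˣ) : A) * h * n, Ideal.mul_mem_left _ _ hnN, ?_, fun h0 => hn0 ?_⟩
  · rw [hg, IsIdempotentElem]
    calc ((U⁻¹ : Aˣ) : A) * h * U * (((U⁻¹ : Aˣ) : A) * h * U)
        = ((U⁻¹ : Aˣ) : A) * h * (U * ((U⁻¹ : Aˣ) : A)) * h * U := by noncomm_ring
      _ = ((U⁻¹ : Aˣ) : A) * (h * h) * U := by rw [Units.mul_inv]; noncomm_ring
      _ = _ := by rw [hh.eq]
  · rw [mul_assoc] at h0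
    have h1 : h * n = 0 := by simpa using h0
    have h2 : n * n ∈ Ring.jacobson A := by
      have : n * n = -((h - n) * n) := by rw [sub_mul, h1]; simp
      rw [this]
      exact neg_mem (Ideal.mul_mem_right _ _ hhn)
    have : n = n * n - (n * n - n) := by abel
    rw [this]
    exact sub_mem h2 hnn

/-- In a semi-perfect ring, the left ideal `A e` of a primitive idempotent `e` is local. -/
lemma IsPrimitiveIdempotent.mem_of_not_le (hA : IsSemiperfectRing A) {e : A}
    (he : IsPrimitiveIdempotent e) {N : Ideal A} (hNe : ∀ n ∈ N, n * e = n)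
    (hN : ¬ N ≤ Ring.jacobson A) : e ∈ N := by
  obtain ⟨g, hgN, hg, hg0⟩ := hA.exists_idempotent_mem hN
  obtain ⟨hee, -, hprim⟩ := he
  have hge := hNe g hgN
  have h1 : e * g * (e * g) = e * g := by
    rw [mul_assoc, ← mul_assoc g, hge, hg.eq]
  have h2 : e * g * e = e * g := by rw [mul_assoc, hge]
  have h3 : e * (e * g) = e * g := by rw [← mul_assoc, hee.eq]
  -- Because `g e = g`, the element `e g` is an idempotent of `e A e`. It is nonzero, as `g = g (e
  -- g)`, so primitivity forces `e g = e`.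
  rcases hprim (e * g) (e - e * g) h1
    (by simp only [IsIdempotentElem, sub_mul, mul_sub, hee.eq, h1, h2, h3]; abel)
    (by rw [mul_sub, h1, h2, sub_self]) (by rw [sub_mul, h3, h1, sub_self]) (by abel) with h | h
  · refine absurd ?_ hg0
    rw [← hg.eq]
    nth_rewrite 1 [← hge]
    rw [mul_assoc, h, mul_zero]
  · rw [sub_eq_zero.1 h]
    exact Ideal.mul_mem_left _ _ hgN

/-! ### Equivalence of idempotents and primitive decompositions -/

/-- Murray–von Neumann equivalence of idempotents: `e = b a` and `f = a b` with `a ∈ f A e`,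
`b ∈ e A f`. -/
def IdempotentEquiv (e f : A) : Prop :=
  ∃ a b : A, f * a = a ∧ a * e = a ∧ e * b = b ∧ b * f = b ∧ a * b = f ∧ b * a = e

/-- Right multiplications by `b` and by `a` are mutually inverse. Idempotency of `e` and `f` follows
from the relations. -/
lemma IdempotentEquiv.nonempty_linearEquiv {e f : A} (h : IdempotentEquiv e f) :
    Nonempty ((Ideal.span {e} : Ideal A) ≃ₗ[A] (Ideal.span {f} : Ideal A)) := by
  obtain ⟨a, b, hfa, hae, heb, hbf, hab, hba⟩ := h
  have key : ∀ {p q c d : A}, c * q = c → d * c = q → ∀ r ∈ Ideal.span {p},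
      r * c ∈ Ideal.span {q} := by
    intro p q c d h _ r _
    rw [← h, ← mul_assoc]
    exact Ideal.mul_mem_left _ _ (Ideal.mem_span_singleton_self q)
  have hef : ∀ {p q c d : A}, c * d = p → IsIdempotentElem p → ∀ r ∈ Ideal.span {p},
      r * c * d = r := by
    intro p q c d h hp r hr
    rw [mul_assoc, h, mul_right_eq_self_of_mem_span hp hr]
  have he : IsIdempotentElem e := by
    rw [IsIdempotentElem]; nth_rewrite 2 [← hba]; rw [← mul_assoc, heb, hba]
  have hf : IsIdempotentElem f := by
    rw [IsIdempotentElem]; nth_rewrite 2 [← hab]; rw [← mul_assoc, hfa, hab]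
  exact ⟨LinearEquiv.ofLinearMap
    ((LinearMap.toSpanSingleton A A b).restrict (key hbf hab))
    ((LinearMap.toSpanSingleton A A a).restrict (key hae hba))
    (LinearMap.ext fun r => Subtype.ext (hef (q := e) hab hf r.1 r.2))
    (LinearMap.ext fun r => Subtype.ext (hef (q := f) hba he r.1 r.2))⟩

/-- Primitive idempotents of a semi-perfect ring are equivalent as soon as they fix nonzero
elements, of one module, which generate each other. -/
lemma IsPrimitiveIdempotent.idempotentEquiv (hA : IsSemiperfectRing A) {e f : A}
    (he : IsPrimitiveIdempotent e) (hf : IsPrimitiveIdempotent f) {M : Type*} [AddCommGroup M]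
    [Module A M] {s t : M} (hs : e • s = s) (ht : f • t = t) (ht0 : t ≠ 0)
    (hst : ∃ b : A, b • t = s) (hts : ∃ c : A, c • s = t) : IdempotentEquiv e f := by
  obtain ⟨b₀, hb₀⟩ := hst
  obtain ⟨c, hc⟩ := hts
  set b := e * b₀ * f with hb
  have hbt : b • t = s := by rw [hb, mul_smul, ht, mul_smul, hb₀, hs]
  have heb : e * b = b := by rw [hb, ← mul_assoc, ← mul_assoc, he.1.eq]
  have hbf : b * f = b := by rw [hb, mul_assoc, hf.1.eq]
  -- The product `c b` fixes `t ≠ 0`, which no element of the radical can do. So `A b ⊆ A f` is not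
  -- in the radical and contains `f` by locality, which supplies a left factor `a` with `a b = f`.
  have hbJ : b ∉ Ring.jacobson A := fun h =>
    ht0 (eq_zero_of_mem_jacobson_smul (Ideal.mul_mem_left _ c h) (by rw [mul_smul, hbt, hc]))
  have hmem : f ∈ Ideal.span {b} := hf.mem_of_not_le hA
    (fun n hn => by
      obtain ⟨r, rfl⟩ := Ideal.mem_span_singleton'.1 hn
      rw [mul_assoc, hbf])
    (fun h => hbJ (h (Ideal.mem_span_singleton_self b)))
  obtain ⟨a₀, ha₀⟩ := Ideal.mem_span_singleton'.1 hmem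
  set a := f * a₀ * e with ha
  have hab : a * b = f := by rw [ha, mul_assoc, heb, mul_assoc, ha₀, hf.1.eq]
  have hfa : f * a = a := by rw [ha, ← mul_assoc, ← mul_assoc, hf.1.eq]
  have hae : a * e = a := by rw [ha, mul_assoc, he.1.eq]
  refine ⟨a, b, hfa, hae, heb, hbf, hab, ?_⟩
  have h1 : b * a * (b * a) = b * a := by rw [mul_assoc, ← mul_assoc a, hab, hfa]
  have h2 : b * a * e = b * a := by rw [mul_assoc, hae]
  have h3 : e * (b * a) = b * a := by rw [← mul_assoc, heb]
  -- Here `b a` is an idempotent of `e A e`, nonzero because `a b = f ≠ 0`; primitivity of `e` gives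
  -- `b a = e`.
  rcases he.2.2 (b * a) (e - b * a) h1
    (by simp only [IsIdempotentElem, sub_mul, mul_sub, he.1.eq, h1, h2, h3]; abel)
    (by rw [mul_sub, h1, h2, sub_self]) (by rw [sub_mul, h3, h1, sub_self]) (by abel) with h | h
  · refine absurd ?_ hf.2.1
    rw [← hf.1.eq]
    nth_rewrite 1 [← hab]
    rw [← hab, mul_assoc, ← mul_assoc b, h, zero_mul, mul_zero]
  · exact (sub_eq_zero.1 h).symm

/-- In a semi-perfect ring, every idempotent is a sum of orthogonal primitive idempotents. -/
lemma IsSemiperfectRing.exists_primitive_sum (hA : IsSemiperfectRing A) (e : A)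
    (he : IsIdempotentElem e) :
    ∃ E : Finset A, (∀ a ∈ E, IsPrimitiveIdempotent a) ∧
      (∀ a ∈ E, ∀ b ∈ E, a ≠ b → a * b = 0) ∧ ∑ a ∈ E, a = e := by
  classical
  have := hA.1
  -- The induction runs on the left ideal generated by the image of `e` in the semisimple quotient,
  -- where descending chains stop. A proper splitting strictly shrinks this ideal because a nonzero
  -- idempotent is never in the radical.
  induction h : Ideal.span {Ideal.Quotient.mk (Ring.jacobson A) e} using
    WellFoundedLT.induction generalizing e with
  | ind I ih =>
    subst h
    by_cases h0 : e = 0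
    · exact ⟨∅, by simp, by simp, by simp [h0]⟩
    by_cases hp : IsPrimitiveIdempotent e
    · exact ⟨{e}, by simpa using hp, by simp, by simp⟩
    have hp' : ∃ f g : A, IsIdempotentElem f ∧ IsIdempotentElem g ∧ f * g = 0 ∧ g * f = 0 ∧
        e = f + g ∧ f ≠ 0 ∧ g ≠ 0 := by
      by_contra hcon
      refine hp ⟨he, h0, fun f g hf hg hfg hgf hs => ?_⟩
      by_contra! hne
      exact hcon ⟨f, g, hf, hg, hfg, hgf, hs, hne.1, hne.2⟩
    obtain ⟨f, g, hf, hg, hfg, hgf, hs, hf0, hg0⟩ := hp'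
    have key : ∀ {f g : A}, IsIdempotentElem f → IsIdempotentElem g → f * g = 0 → g * f = 0 →
        e = f + g → g ≠ 0 → Ideal.span {Ideal.Quotient.mk (Ring.jacobson A) f} <
          Ideal.span {Ideal.Quotient.mk (Ring.jacobson A) e} := by
      intro f g hf hg hfg hgf hs hg0
      refine lt_of_le_of_ne ?_ fun heq => hg0 (hg.eq_zero_of_mem_jacobson ?_)
      · rw [Ideal.span_singleton_le_iff_mem, Ideal.mem_span_singleton']
        exact ⟨Ideal.Quotient.mk _ f, by rw [← map_mul, hs, mul_add, hfg, hf.eq, add_zero]⟩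
      · have : Ideal.Quotient.mk (Ring.jacobson A) e ∈
            Ideal.span {Ideal.Quotient.mk (Ring.jacobson A) f} := by
          rw [heq]; exact Ideal.mem_span_singleton_self _
        obtain ⟨r, hr⟩ := Ideal.mem_span_singleton'.1 this
        have heg : g = e * g := by rw [hs, add_mul, hfg, hg.eq, zero_add]
        rw [← Ideal.Quotient.eq_zero_iff_mem, heg, map_mul, ← hr, mul_assoc, ← map_mul, hfg,
          map_zero, mul_zero]
    obtain ⟨E, hE, hEo, hEs⟩ := ih _ (key hf hg hfg hgf hs hg0) f hf rfl
    obtain ⟨F, hF, hFo, hFs⟩ := ih _ (key hg hf hgf hfg (by rw [hs, add_comm]) hf0) g hg rfl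
    -- Each summand is absorbed by the total on both sides, so orthogonality of `f` and `g` passes
    -- to the members of `E` and `F`.
    have abs : ∀ {G : Finset A} {f : A}, (∀ a ∈ G, IsPrimitiveIdempotent a) →
        (∀ a ∈ G, ∀ b ∈ G, a ≠ b → a * b = 0) → ∑ a ∈ G, a = f →
        ∀ a ∈ G, a * f = a ∧ f * a = a := by
      intro G f hG hGo hGs a ha
      rw [← hGs, Finset.mul_sum, Finset.sum_mul]
      constructor
      · rw [Finset.sum_eq_single_of_mem a ha fun b hb hba => hGo a ha b hb hba.symm,
          (hG a ha).1.eq]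
      · rw [Finset.sum_eq_single_of_mem a ha fun b hb hba => hGo b hb a ha hba, (hG a ha).1.eq]
    have hEF : ∀ a ∈ E, ∀ b ∈ F, a * b = 0 := fun a ha b hb => by
      rw [← (abs hE hEo hEs a ha).1, ← (abs hF hFo hFs b hb).2, mul_assoc, ← mul_assoc f, hfg,
        zero_mul, mul_zero]
    have hFE : ∀ a ∈ F, ∀ b ∈ E, a * b = 0 := fun a ha b hb => by
      rw [← (abs hF hFo hFs a ha).1, ← (abs hE hEo hEs b hb).2, mul_assoc, ← mul_assoc g, hgf,
        zero_mul, mul_zero]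
    have hdisj : Disjoint E F := Finset.disjoint_left.2 fun a ha hb =>
      (hE a ha).2.1 (by rw [← (hE a ha).1.eq]; exact hEF a ha a hb)
    refine ⟨E ∪ F, fun a ha => ?_, fun a ha b hb hab => ?_, ?_⟩
    · rcases Finset.mem_union.1 ha with ha | ha
      exacts [hE a ha, hF a ha]
    · rcases Finset.mem_union.1 ha with ha | ha <;> rcases Finset.mem_union.1 hb with hb | hb
      exacts [hEo a ha b hb hab, hEF a ha b hb, hFE a ha b hb, hFo a ha b hb hab]
    · rw [Finset.sum_union hdisj, hEs, hFs, hs]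

/-- A semi-perfect ring has a complete set of orthogonal primitive idempotents. -/
theorem IsSemiperfectRing.exists_isCompletePrimitiveSet (hA : IsSemiperfectRing A) :
    ∃ E : Finset A, IsCompletePrimitiveSet E := by
  obtain ⟨E, hE, hEo, hEs⟩ := hA.exists_primitive_sum 1 IsIdempotentElem.one
  refine ⟨E, ⟨⟨⟨fun e => (hE e e.2).1, fun e f hef => ?_⟩, ?_⟩, hE⟩⟩
  · exact hEo e e.2 f f.2 fun h => hef (Subtype.ext h)
  · rw [← hEs]
    exact Finset.sum_coe_sort E fun a => a

lemma IsCompletePrimitiveSet.exists_smul_ne_zero {E : Finset A} (hE : IsCompletePrimitiveSet E)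
    {M : Type*} [AddCommGroup M] [Module A M] {m : M} (hm : m ≠ 0) : ∃ e ∈ E, e • m ≠ 0 := by
  by_contra! h
  refine hm ?_
  rw [← one_smul A m, ← hE.1.complete, Finset.sum_smul]
  exact Finset.sum_eq_zero fun e _ => h e e.2

/-! ### Simple quotients of `A e` -/

/-- A linear map `A e → L` is determined by the image of `e`. -/
lemma apply_eq_smul_of_mem_span {e : A} (he : IsIdempotentElem e) {L : Type*} [AddCommGroup L]
    [Module A L] (f : (Ideal.span {e} : Ideal A) →ₗ[A] L) (a : (Ideal.span {e} : Ideal A)) :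
    f a = (a : A) • f ⟨e, Ideal.mem_span_singleton_self e⟩ := by
  rw [← map_smul]
  exact congrArg f (Subtype.ext (mul_right_eq_self_of_mem_span he a.2).symm)

/-- The simple module `L` is a quotient of `A e`. -/
def IsLeftIdealTop (e : A) (L : Type*) [AddCommGroup L] [Module A L] : Prop :=
  ∃ f : (Ideal.span {e} : Ideal A) →ₗ[A] L, Function.Surjective f

/-- Maps `A e → L` correspond to vectors of `L` fixed by `e`, through the image of `e`; a nonzero
map to a simple module is onto. -/
lemma isLeftIdealTop_iff {e : A} (he : IsIdempotentElem e) {L : Type*} [AddCommGroup L] [Module A L]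
    [IsSimpleModule A L] : IsLeftIdealTop e L ↔ ∃ l : L, l ≠ 0 ∧ e • l = l := by
  constructor
  · rintro ⟨f, hf⟩
    refine ⟨f ⟨e, Ideal.mem_span_singleton_self e⟩, fun h0 => ?_, ?_⟩
    · obtain ⟨l, hl⟩ := @exists_ne L (IsSimpleModule.nontrivial A L) 0
      obtain ⟨a, rfl⟩ := hf l
      exact hl (by rw [apply_eq_smul_of_mem_span he, h0, smul_zero])
    · exact (apply_eq_smul_of_mem_span he f ⟨e, Ideal.mem_span_singleton_self e⟩).symm
  · rintro ⟨l, hl, hel⟩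
    refine ⟨(LinearMap.toSpanSingleton A L l).comp (Submodule.subtype _), fun m => ?_⟩
    obtain ⟨a, rfl⟩ := IsSimpleModule.toSpanSingleton_surjective A hl m
    exact ⟨⟨a * e, Ideal.mul_mem_left _ _ (Ideal.mem_span_singleton_self e)⟩,
      by simp [mul_smul, hel]⟩

lemma IsPrimitiveIdempotent.idempotentEquiv_of_isLeftIdealTop (hA : IsSemiperfectRing A) {e f : A}
    (he : IsPrimitiveIdempotent e) (hf : IsPrimitiveIdempotent f) {L : Type*} [AddCommGroup L]
    [Module A L] [IsSimpleModule A L]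
    (heL : IsLeftIdealTop e L) (hfL : IsLeftIdealTop f L) :
    IdempotentEquiv e f := by
  obtain ⟨s, hs0, hs⟩ := (isLeftIdealTop_iff he.1).1 heL
  obtain ⟨t, ht0, ht⟩ := (isLeftIdealTop_iff hf.1).1 hfL
  exact he.idempotentEquiv hA hf hs ht ht0 (IsSimpleModule.toSpanSingleton_surjective A ht0 s)
    (IsSimpleModule.toSpanSingleton_surjective A hs0 t)

lemma IsLeftIdealTop.of_linearEquiv {e f : A} {L : Type*} [AddCommGroup L] [Module A L]
    (h : IsLeftIdealTop f L) (φ : (Ideal.span {e} : Ideal A) ≃ₗ[A] (Ideal.span {f} : Ideal A)) :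
    IsLeftIdealTop e L := by
  obtain ⟨p, hp⟩ := h
  exact ⟨p.comp φ.toLinearMap, hp.comp φ.surjective⟩

/-- The kernel of a map from `A e` onto a simple module is the radical of `A e`. -/
lemma IsPrimitiveIdempotent.ker_eq (hA : IsSemiperfectRing A) {e : A}
    (he : IsPrimitiveIdempotent e) {L : Type*} [AddCommGroup L] [Module A L] [IsSimpleModule A L]
    (f : (Ideal.span {e} : Ideal A) →ₗ[A] L) (hf : Function.Surjective f) :
    LinearMap.ker f = (Ring.jacobson A).submoduleOf (Ideal.span {e}) := by
  set l := f ⟨e, Ideal.mem_span_singleton_self e⟩ with hl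
  have hl0 : l ≠ 0 := fun h0 => by
    obtain ⟨m, hm⟩ := @exists_ne L (IsSimpleModule.nontrivial A L) 0
    obtain ⟨a, rfl⟩ := hf m
    exact hm (by rw [apply_eq_smul_of_mem_span he.1, ← hl, h0, smul_zero])
  ext a
  rw [LinearMap.mem_ker, apply_eq_smul_of_mem_span he.1, ← hl, Submodule.submoduleOf,
    Submodule.mem_comap]
  constructor
  · intro ha
    by_contra hJ
    -- Outside the radical, `a` generates a left ideal containing `e`; so `a l = 0` would give `l =
    -- e l = 0`.
    have hmem : e ∈ Ideal.span {(a : A)} := he.mem_of_not_le hA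
      (fun n hn => by
        obtain ⟨r, rfl⟩ := Ideal.mem_span_singleton'.1 hn
        rw [mul_assoc, mul_right_eq_self_of_mem_span he.1 a.2])
      (fun h => hJ (h (Ideal.mem_span_singleton_self _)))
    obtain ⟨r, hr⟩ := Ideal.mem_span_singleton'.1 hmem
    have hel : e • l = l :=
      (apply_eq_smul_of_mem_span he.1 f ⟨e, Ideal.mem_span_singleton_self e⟩).symm
    exact hl0 (by rw [← hel, ← hr, mul_smul, ha, smul_zero])
  · intro ha
    by_contra h0
    obtain ⟨c, hc⟩ := IsSimpleModule.toSpanSingleton_surjective A h0 l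
    exact hl0 (eq_zero_of_mem_jacobson_smul (Ideal.mul_mem_left _ c ha)
      (by rw [mul_smul]; exact hc))

/-- By `IsPrimitiveIdempotent.ker_eq` the kernel of a surjection onto a simple module does not
depend on that module. -/
lemma IsPrimitiveIdempotent.nonempty_equiv_of_isLeftIdealTop (hA : IsSemiperfectRing A) {e : A}
    (he : IsPrimitiveIdempotent e) {L L' : Type*} [AddCommGroup L] [Module A L]
    [AddCommGroup L'] [Module A L'] [IsSimpleModule A L] [IsSimpleModule A L']
    (h : IsLeftIdealTop e L)
    (h' : IsLeftIdealTop e L') : Nonempty (L ≃ₗ[A] L') := by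
  obtain ⟨f, hf⟩ := h
  obtain ⟨f', hf'⟩ := h'
  exact ⟨(f.quotKerEquivOfSurjective hf).symm ≪≫ₗ
    Submodule.quotEquivOfEq _ _ ((he.ker_eq hA f hf).trans (he.ker_eq hA f' hf').symm) ≪≫ₗ
    f'.quotKerEquivOfSurjective hf'⟩

/-- A nonzero cyclic left ideal `A e` has a simple quotient. -/
lemma exists_isLeftIdealTop {A : Type v} [Ring A] {e : A} (he : e ≠ 0) :
    ∃ L : {L : ModuleCat.{v} A // IsSimpleModule A L}, IsLeftIdealTop e L.1 := by
  have : Module.Finite A (Ideal.span {e} : Ideal A) :=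
    Module.Finite.iff_fg.2 ⟨{e}, by simp⟩
  have : Nontrivial (Ideal.span {e} : Ideal A) :=
    ⟨⟨e, Ideal.mem_span_singleton_self e⟩, 0, fun h => he (congrArg Subtype.val h)⟩
  obtain ⟨m, hm⟩ := IsCoatomic.exists_coatom (Submodule A (Ideal.span {e} : Ideal A))
  exact ⟨⟨ModuleCat.of A ((Ideal.span {e} : Ideal A) ⧸ m), isSimpleModule_iff_isCoatom.2 hm⟩,
    m.mkQ, m.mkQ_surjective⟩

end Rings

/-! ### Representations: action, quotients, irreducibility -/

namespace LinRep

variable {k : Type w} [CommRing k] {C : Type u} [Category.{v} C] [Preadditive C] [Linear k C]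

/-- The action of a morphism of `C` on a representation. -/
def act (M : LinRep k C) {x y : C} (f : x ⟶ y) : M.toFunctor.obj x →ₗ[k] M.toFunctor.obj y :=
  (M.toFunctor.map f).hom

lemma act_id (M : LinRep k C) (x : C) (m : M.toFunctor.obj x) : M.act (𝟙 x) m = m := by
  simp [act]

lemma act_comp (M : LinRep k C) {x y z : C} (f : x ⟶ y) (g : y ⟶ z) (m : M.toFunctor.obj x) :
    M.act (f ≫ g) m = M.act g (M.act f m) := by
  simp [act]

lemma act_add (M : LinRep k C) {x y : C} (f g : x ⟶ y) (m : M.toFunctor.obj x) :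
    M.act (f + g) m = M.act f m + M.act g m := by
  have := M.additive
  simp [act, Functor.map_add]

lemma act_smul (M : LinRep k C) {x y : C} (r : k) (f : x ⟶ y) (m : M.toFunctor.obj x) :
    M.act (r • f) m = r • M.act f m := by
  have := M.additive
  have := M.linear
  simp [act, Functor.map_smul]

/-- The action on a fixed element, as a linear map. -/
def actAt (M : LinRep k C) {x : C} (m : M.toFunctor.obj x) (y : C) :
    (x ⟶ y) →ₗ[k] M.toFunctor.obj y where
  toFun f := M.act f m
  map_add' f g := M.act_add f g m
  map_smul' r f := M.act_smul r f m

lemma act_zero (M : LinRep k C) {x y : C} (m : M.toFunctor.obj x) :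
    M.act (0 : x ⟶ y) m = 0 := map_zero (M.actAt m y)

lemma act_sub (M : LinRep k C) {x y : C} (f g : x ⟶ y) (m : M.toFunctor.obj x) :
    M.act (f - g) m = M.act f m - M.act g m := map_sub (M.actAt m y) f g

lemma app_act {M N : LinRep k C} (φ : M.toFunctor ⟶ N.toFunctor) {x y : C} (f : x ⟶ y)
    (m : M.toFunctor.obj x) : (φ.app y).hom (M.act f m) = N.act f ((φ.app x).hom m) :=
  congrArg (fun h => h.hom m) (φ.naturality f)

/-- The subrepresentation generated by an element. -/
def gen (M : LinRep k C) {x : C} (m : M.toFunctor.obj x) : M.Subrep where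
  carrier y := LinearMap.range (M.actAt m y)
  map_mem := by
    rintro y z f _ ⟨g, rfl⟩
    exact ⟨g ≫ f, M.act_comp g f m⟩

/-- The preimage of a subrepresentation. -/
def Subrep.comap {M N : LinRep k C} (φ : M.toFunctor ⟶ N.toFunctor) (P : N.Subrep) :
    M.Subrep where
  carrier y := (P.carrier y).comap (φ.app y).hom
  map_mem f m hm := by
    have := P.map_mem f hm
    rw [Submodule.mem_comap]
    exact (app_act φ f m).symm ▸ this

/-- The image of a subrepresentation. -/
def Subrep.map {M N : LinRep k C} (φ : M.toFunctor ⟶ N.toFunctor) (P : M.Subrep) :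
    N.Subrep where
  carrier y := (P.carrier y).map (φ.app y).hom
  map_mem := by
    rintro x y f _ ⟨m, hm, rfl⟩
    exact ⟨_, P.map_mem f hm, app_act φ f m⟩

/-- The quotient of a representation by a subrepresentation. -/
def quot (M : LinRep k C) (P : M.Subrep) : LinRep k C where
  toFunctor :=
    { obj := fun y => ModuleCat.of k (M.toFunctor.obj y ⧸ P.carrier y)
      map := fun {y y'} f => ModuleCat.ofHom
        (Submodule.mapQ (P.carrier y) (P.carrier y') (M.act f) fun _ hm => P.map_mem f hm)
      map_id := fun y => ModuleCat.hom_ext <| Submodule.linearMap_qext _ <| LinearMap.ext fun m =>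
        congrArg (Submodule.Quotient.mk (p := P.carrier y)) (M.act_id y m)
      map_comp := fun {_ _ z} f g => ModuleCat.hom_ext <| Submodule.linearMap_qext _ <|
        LinearMap.ext fun m =>
          congrArg (Submodule.Quotient.mk (p := P.carrier z)) (M.act_comp f g m) }
  additive := ⟨fun {_ y f g} => ModuleCat.hom_ext <| Submodule.linearMap_qext _ <|
    LinearMap.ext fun m => congrArg (Submodule.Quotient.mk (p := P.carrier y)) (M.act_add f g m)⟩
  linear := ⟨fun {_ y} f r => ModuleCat.hom_ext <| Submodule.linearMap_qext _ <|
    LinearMap.ext fun m => congrArg (Submodule.Quotient.mk (p := P.carrier y)) (M.act_smul r f m)⟩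

/-- The projection to the quotient. -/
def quotMk (M : LinRep k C) (P : M.Subrep) : M.toFunctor ⟶ (M.quot P).toFunctor where
  app y := ModuleCat.ofHom (P.carrier y).mkQ
  naturality _ _ _ := rfl

lemma hasQuotient_quot (M : LinRep k C) (P : M.Subrep) : M.HasQuotient (M.quot P) :=
  ⟨M.quotMk P, fun y => (P.carrier y).mkQ_surjective⟩

lemma HasQuotient.of_iso_right {M S S' : LinRep k C} (h : M.HasQuotient S)
    (i : S.toFunctor ≅ S'.toFunctor) : M.HasQuotient S' := by
  obtain ⟨φ, hφ⟩ := h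
  exact ⟨φ ≫ i.hom, fun y =>
    ((ConcreteCategory.bijective_of_isIso (i.hom.app y)).surjective).comp (hφ y)⟩

lemma HasQuotient.of_iso_left {M M' S : LinRep k C} (h : M.HasQuotient S)
    (i : M'.toFunctor ≅ M.toFunctor) : M'.HasQuotient S := by
  obtain ⟨φ, hφ⟩ := h
  exact ⟨i.hom ≫ φ, fun y =>
    (hφ y).comp (ConcreteCategory.bijective_of_isIso (i.hom.app y)).surjective⟩

/-- Two quotients of a representation with the same kernel are isomorphic. -/
lemma nonempty_iso_of_ker_eq {M S S' : LinRep k C} (φ : M.toFunctor ⟶ S.toFunctor)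
    (φ' : M.toFunctor ⟶ S'.toFunctor) (hφ : ∀ y, Function.Surjective (φ.app y).hom)
    (hφ' : ∀ y, Function.Surjective (φ'.app y).hom)
    (h : ∀ y m, (φ.app y).hom m = 0 ↔ (φ'.app y).hom m = 0) :
    Nonempty (S.toFunctor ≅ S'.toFunctor) := by
  let E : ∀ y, S.toFunctor.obj y ≃ₗ[k] S'.toFunctor.obj y := fun y =>
    ((φ.app y).hom.quotKerEquivOfSurjective (hφ y)).symm ≪≫ₗ
      Submodule.quotEquivOfEq _ _ (by ext m; exact h y m) ≪≫ₗ
      (φ'.app y).hom.quotKerEquivOfSurjective (hφ' y)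
  have hE : ∀ y m, E y ((φ.app y).hom m) = (φ'.app y).hom m := by
    intro y m
    have : ((φ.app y).hom.quotKerEquivOfSurjective (hφ y)).symm ((φ.app y).hom m) =
        Submodule.Quotient.mk m := by
      rw [LinearEquiv.symm_apply_eq]
      rfl
    simp only [E, LinearEquiv.trans_apply, this]
    rfl
  refine ⟨NatIso.ofComponents (fun y => (E y).toModuleIso) fun {y z} f => ?_⟩
  refine ModuleCat.hom_ext (LinearMap.ext fun s => ?_)
  obtain ⟨m, rfl⟩ := hφ y s
  change E z (S.act f ((φ.app y).hom m)) = S'.act f (E y ((φ.app y).hom m))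
  rw [← app_act, hE, hE, app_act]

/-! ### Irreducible representations and largest proper subrepresentations -/

lemma IsIrreducible.exists_act_eq {S : LinRep k C} (hS : S.IsIrreducible) {x y : C}
    {m : S.toFunctor.obj x} (hm : m ≠ 0) (m' : S.toFunctor.obj y) : ∃ f : x ⟶ y, S.act f m = m' := by
  rcases hS.2 (S.gen m) with h | h
  · have : m ∈ (S.gen m).carrier x := ⟨𝟙 x, S.act_id x m⟩
    rw [h x] at this
    exact absurd this hm
  · have : m' ∈ (S.gen m).carrier y := by rw [h y]; trivial
    exact this

lemma IsIrreducible.surjective {M S : LinRep k C} (hS : S.IsIrreducible)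
    (φ : M.toFunctor ⟶ S.toFunctor) {x : C} {m : M.toFunctor.obj x}
    (hm : (φ.app x).hom m ≠ 0) (y : C) : Function.Surjective (φ.app y).hom := by
  intro s
  obtain ⟨f, hf⟩ := hS.exists_act_eq hm s
  exact ⟨M.act f m, by rw [app_act, hf]⟩

/-- A subrepresentation of the quotient is tested on its preimage in `M`: a proper preimage lies in
`P`, hence becomes zero. -/
lemma quot_isIrreducible {M : LinRep k C} (P : M.Subrep) (hP : ∃ x, P.carrier x ≠ ⊤)
    (h : ∀ N : M.Subrep, (∃ x, N.carrier x ≠ ⊤) → ∀ x, N.carrier x ≤ P.carrier x) :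
    (M.quot P).IsIrreducible := by
  constructor
  · obtain ⟨x, hx⟩ := hP
    exact ⟨x, Submodule.Quotient.nontrivial_iff.2 hx⟩
  · intro N
    by_cases hN : ∃ x, (N.comap (M.quotMk P)).carrier x ≠ ⊤
    · refine Or.inl fun x => (Submodule.eq_bot_iff _).2 fun s hs => ?_
      obtain ⟨m, rfl⟩ := (P.carrier x).mkQ_surjective s
      exact (Submodule.Quotient.mk_eq_zero _).2 (h _ hN x hs)
    · push Not at hN
      refine Or.inr fun x => (Submodule.eq_top_iff').2 fun s => ?_
      obtain ⟨m, rfl⟩ := (P.carrier x).mkQ_surjective s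
      have : m ∈ (N.comap (M.quotMk P)).carrier x := by rw [hN x]; trivial
      exact this

/-- If `P` contains every proper subrepresentation, then any irreducible quotient of `M` is
isomorphic to `M / P`. -/
lemma IsIrreducible.nonempty_iso_quot {M S : LinRep k C} (hS : S.IsIrreducible) (P : M.Subrep)
    (hP : ∃ x, P.carrier x ≠ ⊤)
    (h : ∀ N : M.Subrep, (∃ x, N.carrier x ≠ ⊤) → ∀ x, N.carrier x ≤ P.carrier x)
    (hMS : M.HasQuotient S) : Nonempty (S.toFunctor ≅ (M.quot P).toFunctor) := by
  obtain ⟨φ, hφ⟩ := hMS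
  -- The kernel of `φ`, seen as the preimage of zero, is proper because `S` is nonzero; hence it
  -- lies in `P`.
  have hbot : ∃ x, ((⟨fun _ => ⊥, fun f m hm => by
      rw [Submodule.mem_bot] at hm ⊢; rw [hm, map_zero]⟩ : S.Subrep).comap φ).carrier x ≠ ⊤ := by
    obtain ⟨x, hx⟩ := hS.1
    obtain ⟨s, hs⟩ := exists_ne (0 : S.toFunctor.obj x)
    obtain ⟨m, rfl⟩ := hφ x s
    refine ⟨x, fun htop => hs ?_⟩
    have : m ∈ (⊤ : Submodule k (M.toFunctor.obj x)) := trivial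
    rw [← htop] at this
    exact this
  have hker := h _ hbot
  refine nonempty_iso_of_ker_eq φ (M.quotMk P) hφ (fun y => (P.carrier y).mkQ_surjective) ?_
  intro y m
  refine ⟨fun hm => (Submodule.Quotient.mk_eq_zero _).2 (hker y hm), fun hm => ?_⟩
  have hm' : m ∈ P.carrier y := (Submodule.Quotient.mk_eq_zero _).1 hm
  -- If `P` mapped onto `S`, then, since it contains the kernel of `φ`, it would be all of `M`.
  rcases hS.2 (P.map φ) with hb | ht
  · have : (φ.app y).hom m ∈ (P.map φ).carrier y := ⟨m, hm', rfl⟩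
    rw [hb y] at this
    exact this
  · obtain ⟨x, hx⟩ := hP
    refine absurd ((Submodule.eq_top_iff').2 fun n => ?_) hx
    have : (φ.app x).hom n ∈ (P.map φ).carrier x := by rw [ht x]; trivial
    obtain ⟨p, hp, hpn⟩ := this
    have hk : n - p ∈ P.carrier x := hker x (by
      change (φ.app x).hom (n - p) = 0
      rw [map_sub, hpn, sub_self])
    have := add_mem hk hp
    rwa [sub_add_cancel] at this

/-- If `P` is proper and contains every proper subrepresentation of `M`, then `M` is
indecomposable. -/
lemma isIndecomposable_of_largest {M : LinRep k C} (P : M.Subrep) (hP : ∃ x, P.carrier x ≠ ⊤)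
    (h : ∀ N : M.Subrep, (∃ x, N.carrier x ≠ ⊤) → ∀ x, N.carrier x ≤ P.carrier x) :
    M.IsIndecomposable := by
  constructor
  · obtain ⟨x, hx⟩ := hP
    refine ⟨x, ?_⟩
    by_contra hs
    rw [not_nontrivial_iff_subsingleton] at hs
    exact hx (Subsingleton.elim _ _)
  · intro N N' hNN'
    by_cases hN : ∃ x, N.carrier x ≠ ⊤
    · by_cases hN' : ∃ x, N'.carrier x ≠ ⊤
      · obtain ⟨x, hx⟩ := hP
        refine absurd (top_le_iff.1 ?_) hx
        rw [← (hNN' x).sup_eq_top]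
        exact sup_le (h N hN x) (h N' hN' x)
      · push Not at hN'
        exact Or.inl fun x => by simpa [hN' x] using (hNN' x).inf_eq_bot
    · push Not at hN
      exact Or.inr fun x => by simpa [hN x] using (hNN' x).inf_eq_bot

end LinRep

/-! ### Standard modules -/

namespace GenReedy

variable {k : Type w} [CommRing k] {C : Type u} [Category.{v} C] [Preadditive C] [Linear k C]

/-! ### Morphisms modulo the ideal of lower degree -/

/-- A nonzero `f ∈ C⁻(x, z)` has `d(z) < d(x)`, so that `f ≫ g` lies in the ideal, or `z = x`; in
the latter case `C⁻(x, x) = C⁺(x, x)` puts `f ≫ g` in `C⁺`. -/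
lemma exists_plus_sub_mem_ideal (R : GenReedy.{t} k C) {x y : C} (h : x ⟶ y) :
    ∃ g ∈ R.plus.hom x y, h - g ∈ R.ideal (R.deg x) x y := by
  have hh := R.mem_span_comp h
  induction hh using Submodule.span_induction with
  | zero => exact ⟨0, zero_mem _, by simp⟩
  | add a b _ _ ha hb =>
    obtain ⟨g, hg, hga⟩ := ha
    obtain ⟨g', hg', hgb⟩ := hb
    exact ⟨g + g', add_mem hg hg', by rw [add_sub_add_comm]; exact add_mem hga hgb⟩
  | smul r a _ ha =>
    obtain ⟨g, hg, hga⟩ := ha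
    exact ⟨r • g, Submodule.smul_mem _ r hg, by
      rw [← smul_sub]; exact Submodule.smul_mem _ r hga⟩
  | mem a ha =>
    obtain ⟨z, f, g, hf, hg, rfl⟩ := ha
    by_cases h0 : R.minus.hom x z = ⊥
    · rw [h0, Submodule.mem_bot] at hf
      exact ⟨0, zero_mem _, by simp [hf]⟩
    · rcases R.minus_deg x z h0 with rfl | hlt
      · rw [← R.diag x] at hf
        exact ⟨f ≫ g, R.plus.comp_mem hf hg, by simp⟩
      · exact ⟨0, zero_mem _, by
          rw [sub_zero]; exact Submodule.subset_span ⟨z, f, g, hlt, hf, hg, rfl⟩⟩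

lemma exists_endAlg_sub_mem_ideal (R : GenReedy.{t} k C) {x : C} (h : x ⟶ x) :
    ∃ a : R.A0 x, h - End.asHom a.1 ∈ R.ideal (R.deg x) x x := by
  obtain ⟨g, hg, h⟩ := R.exists_plus_sub_mem_ideal h
  exact ⟨⟨g, hg, by rw [← R.diag x]; exact hg⟩, h⟩

/-- Recording the support of a preimage lets injectivity of `compSum` separate the ideal from
`A_x^0`. -/
lemma exists_compSum_eq_of_mem_ideal (R : GenReedy.{t} k C) {α : Set.Iio R.lam} {x y : C}
    {h : x ⟶ y} (hh : h ∈ R.ideal α x y) :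
    ∃ s : (⨁ z : C, BalancedTensor k (R.A0 z) (R.plus.hom z y) (R.minus.hom x z)),
      LinSubcat.compSum R.plus R.minus x y s = h ∧ ∀ z, ¬ R.deg z < α → s z = 0 := by
  classical
  induction hh using Submodule.span_induction with
  | zero => exact ⟨0, by simp, fun _ _ => rfl⟩
  | add a b _ _ ha hb =>
    obtain ⟨s, hs, hs0⟩ := ha
    obtain ⟨s', hs', hs0'⟩ := hb
    exact ⟨s + s', by rw [map_add, hs, hs'], fun z hz => by
      rw [DirectSum.add_apply, hs0 z hz, hs0' z hz, add_zero]⟩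
  | smul r a _ ha =>
    obtain ⟨s, hs, hs0⟩ := ha
    exact ⟨r • s, by rw [map_smul, hs], fun z hz => by
      rw [DirectSum.smul_apply, hs0 z hz, smul_zero]⟩
  | mem a ha =>
    obtain ⟨z, f, g, hz, hf, hg, rfl⟩ := ha
    refine ⟨DirectSum.of (fun z : C => BalancedTensor k (R.A0 z) (R.plus.hom z y)
      (R.minus.hom x z)) z (Submodule.Quotient.mk ((⟨g, hg⟩ : R.plus.hom z y) ⊗ₜ
        (⟨f, hf⟩ : R.minus.hom x z))), ?_, fun z' hz' => ?_⟩
    · convert R.compSum_of x y z _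
      rfl
    · exact DirectSum.of_eq_of_ne _ _ _ fun h => hz' (h ▸ hz)

/-- The sum `C(x, x) = A_x^0 + I_{d(x)}(x, x)` is direct. -/
lemma eq_zero_of_mem_ideal (R : GenReedy.{t} k C) {x : C} (a : R.A0 x)
    (ha : (a.1 : x ⟶ x) ∈ R.ideal (R.deg x) x x) : a = 0 := by
  classical
  obtain ⟨s, hs, hs0⟩ := R.exists_compSum_eq_of_mem_ideal ha
  -- The element `a` is the image of `a ⊗ 1` in the summand `z = x`. By injectivity this is `s`,
  -- whose component at `x` vanishes because `d(x) < d(x)` fails.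
  set p : BalancedTensor k (R.A0 x) (R.plus.hom x x) (R.minus.hom x x) :=
    Submodule.Quotient.mk ((⟨a.1, a.2.1⟩ : R.plus.hom x x) ⊗ₜ
      (⟨𝟙 x, R.minus.id_mem x⟩ : R.minus.hom x x)) with hp
  have hpa : LinSubcat.compTensor R.plus R.minus x x x p = (a.1 : x ⟶ x) := Category.id_comp _
  have hcs := R.compSum_of x x x p
  have heq : s = DirectSum.of (fun z : C =>
      BalancedTensor k (R.A0 z) (R.plus.hom z x) (R.minus.hom x z)) x p := by
    apply (R.comp_bijective x x).1
    rw [hs, ← hpa, ← hcs]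
  have hp0 : p = 0 := by
    rw [← hs0 x (lt_irrefl _), heq]
    exact (DirectSum.of_eq_same (β := fun z : C =>
      BalancedTensor k (R.A0 z) (R.plus.hom z x) (R.minus.hom x z)) x p).symm
  refine Subtype.ext ?_
  rw [hp0, map_zero] at hpa
  exact hpa.symm

/-! ### Modules vanishing in lower degrees -/

/-- A representation which vanishes on the objects of degree less than that of `x`. -/
def VanishesBelow (R : GenReedy.{t} k C) (M : LinRep k C) (x : C) : Prop :=
  ∀ z : C, R.deg z < R.deg x → Subsingleton (M.toFunctor.obj z)

/-- Each generator of the ideal factors through an object on which `M` is zero. -/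
lemma VanishesBelow.act_eq_zero {R : GenReedy.{t} k C} {M : LinRep k C} {x : C}
    (hM : R.VanishesBelow M x) {y : C} {f : x ⟶ y} (hf : f ∈ R.ideal (R.deg x) x y)
    (m : M.toFunctor.obj x) : M.act f m = 0 := by
  have hle : R.ideal (R.deg x) x y ≤ LinearMap.ker (M.actAt m y) := by
    refine Submodule.span_le.2 ?_
    rintro _ ⟨z, f, g, hz, -, -, rfl⟩
    have := hM z hz
    change M.act (f ≫ g) m = 0
    rw [M.act_comp, Subsingleton.elim (M.act f m) 0, map_zero]
  exact hle hf

lemma VanishesBelow.exists_act_eq {R : GenReedy.{t} k C} {M : LinRep k C} {x : C}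
    (hM : R.VanishesBelow M x) (h : x ⟶ x) :
    ∃ a : R.A0 x, ∀ m : M.toFunctor.obj x, M.act h m = M.act (a.1 : x ⟶ x) m := by
  obtain ⟨a, ha⟩ := R.exists_endAlg_sub_mem_ideal h
  exact ⟨a, fun m => sub_eq_zero.1 ((M.act_sub h a.1 m).symm.trans (hM.act_eq_zero ha m))⟩

/-- The value at `x` of a representation is a module over `A_x^0`. -/
abbrev objModule (R : GenReedy.{t} k C) (M : LinRep k C) (x : C) :
    Module (R.A0 x) (M.toFunctor.obj x) where
  smul a m := M.act (a.1 : x ⟶ x) m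
  one_smul m := M.act_id x m
  mul_smul a b m := M.act_comp (b.1 : x ⟶ x) (a.1 : x ⟶ x) m
  smul_zero a := map_zero (M.act (a.1 : x ⟶ x))
  smul_add a m n := map_add (M.act (a.1 : x ⟶ x)) m n
  add_smul a b m := M.act_add (a.1 : x ⟶ x) (b.1 : x ⟶ x) m
  zero_smul m := M.act_zero m

/-! ### The generator and the universal property of standard modules -/

/-- The generator of the standard module. -/
def standardGen (R : GenReedy.{t} k C) (x : C) (e : R.A0 x) :
    (R.standard x e).toFunctor.obj x :=
  Submodule.Quotient.mk (p := (R.idealMul (e.1 : x ⟶ x) x).submoduleOf (principal (e.1 : x ⟶ x) x))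
    (⟨(e.1 : x ⟶ x), 𝟙 x, Category.comp_id _⟩ : principal (k := k) (e.1 : x ⟶ x) x)

lemma act_standardGen (R : GenReedy.{t} k C) {x : C} (e : R.A0 x) {y : C} (f : x ⟶ y) :
    (R.standard x e).act f (R.standardGen x e) =
      Submodule.Quotient.mk
        (p := (R.idealMul (e.1 : x ⟶ x) y).submoduleOf (principal (e.1 : x ⟶ x) y))
        (⟨(e.1 : x ⟶ x) ≫ f, f, rfl⟩ : principal (k := k) (e.1 : x ⟶ x) y) := rfl

lemma exists_act_standardGen_eq (R : GenReedy.{t} k C) {x : C} (e : R.A0 x) {y : C}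
    (m : (R.standard x e).toFunctor.obj y) :
    ∃ f : x ⟶ y, (R.standard x e).act f (R.standardGen x e) = m := by
  obtain ⟨⟨_, f, rfl⟩, rfl⟩ := Submodule.Quotient.mk_surjective _ m
  exact ⟨f, rfl⟩

lemma comp_self_of_isIdempotentElem (R : GenReedy.{t} k C) {x : C} {e : R.A0 x}
    (he : IsIdempotentElem e) : (e.1 : x ⟶ x) ≫ (e.1 : x ⟶ x) = e.1 :=
  congrArg Subtype.val he.eq

lemma endAlg_comp_mem_ideal (R : GenReedy.{t} k C) {x : C} (e : R.A0 x) {α : Set.Iio R.lam}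
    {y : C} {f : x ⟶ y} (hf : f ∈ R.ideal α x y) : (e.1 : x ⟶ x) ≫ f ∈ R.ideal α x y := by
  have hle : R.ideal α x y ≤ (R.ideal α x y).comap (Linear.leftComp k y (e.1 : x ⟶ x)) := by
    refine Submodule.span_le.2 ?_
    rintro _ ⟨z, f, g, hz, hf, hg, rfl⟩
    exact Submodule.subset_span ⟨z, (e.1 : x ⟶ x) ≫ f, g, hz, R.minus.comp_mem e.2.2 hf, hg,
      (Category.assoc (e.1 : x ⟶ x) f g).symm⟩
  exact hle hf

/-- The submodule `I_α e` lies in `I_α`, and idempotency of `e` gives the converse on `C e`: an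
element of both equals itself times `e`. -/
lemma act_standardGen_eq_zero_iff (R : GenReedy.{t} k C) {x : C} {e : R.A0 x}
    (he : IsIdempotentElem e) {y : C} (f : x ⟶ y) :
    (R.standard x e).act f (R.standardGen x e) = 0 ↔
      (e.1 : x ⟶ x) ≫ f ∈ R.ideal (R.deg x) x y := by
  rw [act_standardGen]
  refine (Submodule.Quotient.mk_eq_zero _).trans ?_
  constructor
  · rintro ⟨g, hg, hgf⟩
    have hgf' : (e.1 : x ⟶ x) ≫ g = (e.1 : x ⟶ x) ≫ f := hgf
    rw [← hgf']
    exact R.endAlg_comp_mem_ideal e hg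
  · intro h
    refine ⟨(e.1 : x ⟶ x) ≫ f, h, ?_⟩
    change (e.1 : x ⟶ x) ≫ (e.1 : x ⟶ x) ≫ f = (e.1 : x ⟶ x) ≫ f
    rw [← Category.assoc, R.comp_self_of_isIdempotentElem he]

lemma act_standardGen_self (R : GenReedy.{t} k C) {x : C} {e : R.A0 x}
    (he : IsIdempotentElem e) :
    (R.standard x e).act (e.1 : x ⟶ x) (R.standardGen x e) = R.standardGen x e := by
  rw [← sub_eq_zero]
  nth_rewrite 2 [← (R.standard x e).act_id x (R.standardGen x e)]
  rw [← LinRep.act_sub, R.act_standardGen_eq_zero_iff he, Preadditive.comp_sub,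
    R.comp_self_of_isIdempotentElem he, Category.comp_id, sub_self]
  exact zero_mem _

/-- Directness of `C(x, x) = A_x^0 + I_{d(x)}(x, x)` is what makes `A_x^0 e` embed in the standard
module at `x`. -/
lemma act_standardGen_endAlg_eq_zero_iff (R : GenReedy.{t} k C) {x : C} {e : R.A0 x}
    (he : IsIdempotentElem e) (a : R.A0 x) :
    (R.standard x e).act (a.1 : x ⟶ x) (R.standardGen x e) = 0 ↔ a * e = 0 := by
  rw [R.act_standardGen_eq_zero_iff he]
  refine ⟨fun h => R.eq_zero_of_mem_ideal (a * e) h, fun h => ?_⟩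
  have : (e.1 : x ⟶ x) ≫ (a.1 : x ⟶ x) = 0 := congrArg Subtype.val h
  rw [this]
  exact zero_mem _

lemma standardGen_ne_zero (R : GenReedy.{t} k C) {x : C} {e : R.A0 x}
    (he : IsIdempotentElem e) (h0 : e ≠ 0) : R.standardGen x e ≠ 0 := by
  intro h
  apply h0
  rw [← he.eq, ← R.act_standardGen_endAlg_eq_zero_iff he, h, map_zero]

/-- Modulo the ideal every `e ≫ f` is represented in `C⁺(x, y)`, so the degree condition on `C⁺`
bounds the support. -/
lemma standard_support (R : GenReedy.{t} k C) {x : C} {e : R.A0 x} (he : IsIdempotentElem e)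
    {y : C} {m : (R.standard x e).toFunctor.obj y} (hm : m ≠ 0) : x = y ∨ R.deg x < R.deg y := by
  obtain ⟨f, rfl⟩ := R.exists_act_standardGen_eq e m
  refine R.plus_deg x y fun h0 => hm ?_
  rw [R.act_standardGen_eq_zero_iff he]
  obtain ⟨g, hg, hgf⟩ := R.exists_plus_sub_mem_ideal ((e.1 : x ⟶ x) ≫ f)
  rw [h0, Submodule.mem_bot] at hg
  rwa [hg, sub_zero] at hgf

lemma standard_vanishesBelow (R : GenReedy.{t} k C) {x : C} {e : R.A0 x}
    (he : IsIdempotentElem e) : R.VanishesBelow (R.standard x e) x := by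
  intro z hz
  refine subsingleton_of_forall_eq 0 fun m => ?_
  by_contra hm
  rcases R.standard_support he hm with rfl | h
  · exact lt_irrefl _ hz
  · exact lt_asymm hz h

/-- The universal property of the standard module. -/
lemma exists_hom_standard (R : GenReedy.{t} k C) {x : C} (e : R.A0 x) {M : LinRep k C}
    (hM : R.VanishesBelow M x) {m : M.toFunctor.obj x} (hm : M.act (e.1 : x ⟶ x) m = m) :
    ∃ φ : (R.standard x e).toFunctor ⟶ M.toFunctor,
      (φ.app x).hom (R.standardGen x e) = m := by
  let F : ∀ y : C, (principal (k := k) (e.1 : x ⟶ x) y ⧸ (R.idealMul (e.1 : x ⟶ x) y).submoduleOf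
      (principal (e.1 : x ⟶ x) y)) →ₗ[k] M.toFunctor.obj y := fun y =>
    Submodule.liftQ _ ((M.actAt m y).comp (principal (k := k) (e.1 : x ⟶ x) y).subtype) (by
      rintro ⟨_, _⟩ ⟨g, hg, rfl⟩
      change M.act ((e.1 : x ⟶ x) ≫ g) m = 0
      rw [M.act_comp, hm, hM.act_eq_zero hg])
  -- The generator is the class of `e`, which `F x` sends to `M.act e m`; hence `hm` is the required
  -- value.
  refine ⟨{ app := fun y => ModuleCat.ofHom (F y), naturality := fun y z f => ?_ }, hm⟩
  refine ModuleCat.hom_ext <| Submodule.linearMap_qext _ <| LinearMap.ext fun g => ?_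
  exact M.act_comp g.1 f m

lemma hom_standard_ext (R : GenReedy.{t} k C) {x : C} (e : R.A0 x) {M : LinRep k C}
    {φ ψ : (R.standard x e).toFunctor ⟶ M.toFunctor}
    (h : (φ.app x).hom (R.standardGen x e) = (ψ.app x).hom (R.standardGen x e)) : φ = ψ := by
  ext y m
  obtain ⟨f, rfl⟩ := R.exists_act_standardGen_eq e m
  exact (LinRep.app_act φ f _).trans ((congrArg (M.act f) h).trans (LinRep.app_act ψ f _).symm)

lemma act_act_endAlg (R : GenReedy.{t} k C) {x : C} (M : LinRep k C) (a c : R.A0 x)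
    (m : M.toFunctor.obj x) :
    M.act (a.1 : x ⟶ x) (M.act (c.1 : x ⟶ x) m) = M.act ((a * c).1 : x ⟶ x) m :=
  (M.act_comp (c.1 : x ⟶ x) (a.1 : x ⟶ x) m).symm

/-- The vector `c · standardGen` is fixed by `p`, so the universal property applies. The two
elements of an idempotent equivalence thus yield inverse morphisms. -/
lemma exists_hom_standard_standard (R : GenReedy.{t} k C) {x : C} {p q c : R.A0 x}
    (hq : IsIdempotentElem q) (hc : p * c = c) :
    ∃ φ : (R.standard x p).toFunctor ⟶ (R.standard x q).toFunctor,
      (φ.app x).hom (R.standardGen x p) =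
        (R.standard x q).act (c.1 : x ⟶ x) (R.standardGen x q) :=
  R.exists_hom_standard p (R.standard_vanishesBelow hq) (by rw [R.act_act_endAlg, hc])

lemma comp_eq_id_of_app_standardGen (R : GenReedy.{t} k C) {x : C} {e f a b : R.A0 x}
    (he : IsIdempotentElem e) (hba : b * a = e)
    {φ : (R.standard x e).toFunctor ⟶ (R.standard x f).toFunctor}
    {ψ : (R.standard x f).toFunctor ⟶ (R.standard x e).toFunctor}
    (hφ : (φ.app x).hom (R.standardGen x e) =
      (R.standard x f).act (b.1 : x ⟶ x) (R.standardGen x f))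
    (hψ : (ψ.app x).hom (R.standardGen x f) =
      (R.standard x e).act (a.1 : x ⟶ x) (R.standardGen x e)) :
    φ ≫ ψ = 𝟙 (R.standard x e).toFunctor := by
  refine R.hom_standard_ext e (M := R.standard x e) ?_
  calc (ψ.app x).hom ((φ.app x).hom (R.standardGen x e))
      = (ψ.app x).hom ((R.standard x f).act (b.1 : x ⟶ x) (R.standardGen x f)) :=
        congrArg (ψ.app x).hom hφ
    _ = (R.standard x e).act (b.1 : x ⟶ x) ((ψ.app x).hom (R.standardGen x f)) :=
        LinRep.app_act ψ _ _
    _ = (R.standard x e).act (e.1 : x ⟶ x) (R.standardGen x e) := by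
        rw [hψ, R.act_act_endAlg, hba]
    _ = R.standardGen x e := R.act_standardGen_self he

lemma nonempty_standard_iso (R : GenReedy.{t} k C) {x : C} {e f : R.A0 x}
    (he : IsIdempotentElem e) (hf : IsIdempotentElem f) (h : IdempotentEquiv e f) :
    Nonempty ((R.standard x e).toFunctor ≅ (R.standard x f).toFunctor) := by
  obtain ⟨a, b, hfa, -, heb, -, hab, hba⟩ := h
  obtain ⟨φ, hφ⟩ := R.exists_hom_standard_standard hf heb
  obtain ⟨ψ, hψ⟩ := R.exists_hom_standard_standard he hfa
  exact ⟨⟨φ, ψ, R.comp_eq_id_of_app_standardGen he hba hφ hψ,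
    R.comp_eq_id_of_app_standardGen hf hab hψ hφ⟩⟩

/-! ### The largest proper submodule of a standard module -/

/-- The image of the radical of `A_x^0` in the value at `x` of the standard module. -/
def standardRadAt (R : GenReedy.{t} k C) {x : C} (e : R.A0 x) :
    Submodule k ((R.standard x e).toFunctor.obj x) :=
  ((Ring.jacobson (R.A0 x)).restrictScalars k).map
    (((R.standard x e).actAt (R.standardGen x e) x).comp (R.A0 x).val.toLinearMap)

/-- The elements of the standard module which every morphism to `x` sends into the radical of
its value at `x`. -/
def standardRad (R : GenReedy.{t} k C) {x : C} (e : R.A0 x) : (R.standard x e).Subrep where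
  carrier y := ⨅ h : y ⟶ x, (R.standardRadAt e).comap ((R.standard x e).act h)
  map_mem := by
    intro y z f m hm
    rw [Submodule.mem_iInf] at hm ⊢
    intro h
    have := hm (f ≫ h)
    rw [Submodule.mem_comap, LinRep.act_comp] at this
    exact this

lemma mem_standardRad_iff (R : GenReedy.{t} k C) {x : C} (e : R.A0 x) {y : C}
    (m : (R.standard x e).toFunctor.obj y) :
    m ∈ (R.standardRad e).carrier y ↔ ∀ h : y ⟶ x, ∃ j ∈ Ring.jacobson (R.A0 x),
      (R.standard x e).act (j.1 : x ⟶ x) (R.standardGen x e) = (R.standard x e).act h m :=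
  Submodule.mem_iInf _

lemma standardGen_notMem_standardRad (R : GenReedy.{t} k C) {x : C} {e : R.A0 x}
    (he : IsIdempotentElem e) (h0 : e ≠ 0) : R.standardGen x e ∉ (R.standardRad e).carrier x := by
  intro h
  obtain ⟨j, hj, hj'⟩ := (R.mem_standardRad_iff e _).1 h (𝟙 x)
  rw [LinRep.act_id] at hj'
  let := R.objModule (R.standard x e) x
  exact R.standardGen_ne_zero he h0 (eq_zero_of_mem_jacobson_smul hj hj')

lemma standardRad_ne_top (R : GenReedy.{t} k C) {x : C} {e : R.A0 x}
    (he : IsIdempotentElem e) (h0 : e ≠ 0) : ∃ y, (R.standardRad e).carrier y ≠ ⊤ :=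
  ⟨x, fun h => R.standardGen_notMem_standardRad he h0 (by rw [h]; trivial)⟩

/-- The standard module of a primitive idempotent has a largest proper subrepresentation. -/
lemma le_standardRad (R : GenReedy.{t} k C) {x : C} (hA : IsSemiperfectRing (R.A0 x))
    {e : R.A0 x} (he : IsPrimitiveIdempotent e) (N : (R.standard x e).Subrep)
    (hN : ∃ y, N.carrier y ≠ ⊤) (y : C) : N.carrier y ≤ (R.standardRad e).carrier y := by
  let := R.objModule (R.standard x e) x
  have hgen : R.standardGen x e ∉ N.carrier x := by
    intro h
    obtain ⟨y, hy⟩ := hN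
    refine hy ((Submodule.eq_top_iff').2 fun m => ?_)
    obtain ⟨f, rfl⟩ := R.exists_act_standardGen_eq e m
    exact N.map_mem f h
  -- The condition `a * e = a` keeps `I` inside `A_x^0 e`, where locality applies: if `I` escaped
  -- the radical it would contain `e`, and `N` would contain the generator.
  let I : Ideal (R.A0 x) :=
    { carrier := {a | a * e = a ∧ a • R.standardGen x e ∈ N.carrier x}
      add_mem' := fun {a b} ha hb => ⟨by rw [add_mul, ha.1, hb.1], by
        rw [add_smul]; exact add_mem ha.2 hb.2⟩
      zero_mem' := ⟨zero_mul e, by rw [zero_smul]; exact zero_mem _⟩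
      smul_mem' := fun a b hb => ⟨by rw [smul_eq_mul, mul_assoc, hb.1], by
        rw [smul_eq_mul, mul_smul]; exact N.map_mem (a.1 : x ⟶ x) hb.2⟩ }
  have hegen : e • R.standardGen x e = R.standardGen x e := R.act_standardGen_self he.1
  have hI : I ≤ Ring.jacobson (R.A0 x) := by
    by_contra hI
    have heI : e ∈ I := he.mem_of_not_le hA (fun n hn => hn.1) hI
    exact hgen (hegen ▸ heI.2)
  intro m hm
  rw [R.mem_standardRad_iff]
  intro h
  obtain ⟨f, hf⟩ := R.exists_act_standardGen_eq e ((R.standard x e).act h m)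
  obtain ⟨a, ha⟩ := (R.standard_vanishesBelow he.1).exists_act_eq f
  have ha' : a • R.standardGen x e = (R.standard x e).act h m := (ha _).symm.trans hf
  -- Replacing `a` by `a * e` puts it into `A_x^0 e` without changing its action on the generator,
  -- which `e` fixes.
  refine ⟨a * e, hI ⟨by rw [mul_assoc, he.1.eq], ?_⟩, ?_⟩
  · rw [mul_smul, hegen, ha']
    exact N.map_mem h hm
  · change (a * e) • R.standardGen x e = _
    rw [mul_smul, hegen, ha']

/-- The simple quotient of a standard module. -/
def simpleTop (R : GenReedy.{t} k C) {x : C} (e : R.A0 x) : LinRep k C :=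
  (R.standard x e).quot (R.standardRad e)

lemma simpleTop_isIrreducible (R : GenReedy.{t} k C) {x : C} (hA : IsSemiperfectRing (R.A0 x))
    {e : R.A0 x} (he : IsPrimitiveIdempotent e) : (R.simpleTop e).IsIrreducible :=
  LinRep.quot_isIrreducible _ (R.standardRad_ne_top he.1 he.2.1) (R.le_standardRad hA he)

theorem standard_isIndecomposable (R : GenReedy.{t} k C) {x : C}
    (hA : IsSemiperfectRing (R.A0 x)) {e : R.A0 x} (he : IsPrimitiveIdempotent e) :
    (R.standard x e).IsIndecomposable :=
  LinRep.isIndecomposable_of_largest _ (R.standardRad_ne_top he.1 he.2.1) (R.le_standardRad hA he)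

/-- The standard module of a primitive idempotent has a unique irreducible quotient. -/
lemma hasQuotient_standard_iff (R : GenReedy.{t} k C) {x : C} (hA : IsSemiperfectRing (R.A0 x))
    {e : R.A0 x} (he : IsPrimitiveIdempotent e) {S : LinRep k C} (hS : S.IsIrreducible) :
    (R.standard x e).HasQuotient S ↔ (R.simpleTop e).cls = S.cls := by
  constructor
  · intro h
    obtain ⟨i⟩ := hS.nonempty_iso_quot _ (R.standardRad_ne_top he.1 he.2.1)
      (R.le_standardRad hA he) h
    exact Quotient.sound ⟨i.symm⟩
  · intro h
    obtain ⟨i⟩ := Quotient.exact h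
    exact (LinRep.hasQuotient_quot _ _).of_iso_right i

/-! ### Recovering the object and the idempotent from a simple module -/

/-- The image of the generator generates the nonzero module `S`, so it is a nonzero vector fixed by
`e`; the support bound descends to the quotient. -/
lemma exists_ne_zero_of_hasQuotient (R : GenReedy.{t} k C) {x : C} {e : R.A0 x}
    (he : IsIdempotentElem e) {S : LinRep k C} (hS : S.IsIrreducible)
    (h : (R.standard x e).HasQuotient S) :
    (∃ s : S.toFunctor.obj x, s ≠ 0 ∧ S.act (e.1 : x ⟶ x) s = s) ∧ R.VanishesBelow S x ∧
      ∀ y, Nontrivial (S.toFunctor.obj y) → x = y ∨ R.deg x < R.deg y := by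
  obtain ⟨φ, hφ⟩ := h
  have hsupp : ∀ y, Nontrivial (S.toFunctor.obj y) → x = y ∨ R.deg x < R.deg y := by
    intro y hy
    obtain ⟨s, hs⟩ := exists_ne (0 : S.toFunctor.obj y)
    obtain ⟨m, rfl⟩ := hφ y s
    exact R.standard_support he (m := m) fun hm => hs (by rw [hm, map_zero])
  refine ⟨⟨(φ.app x).hom (R.standardGen x e), fun h0 => ?_, ?_⟩, fun z hz => ?_, hsupp⟩
  · obtain ⟨y, hy⟩ := hS.1
    obtain ⟨s, hs⟩ := exists_ne (0 : S.toFunctor.obj y)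
    obtain ⟨m, rfl⟩ := hφ y s
    obtain ⟨f, rfl⟩ := R.exists_act_standardGen_eq e m
    exact hs (by rw [LinRep.app_act, h0, map_zero])
  · rw [← LinRep.app_act, R.act_standardGen_self he]
  · by_contra hn
    rw [not_subsingleton_iff_nontrivial] at hn
    rcases hsupp z hn with rfl | h
    · exact lt_irrefl _ hz
    · exact lt_asymm hz h

/-- Standard modules with a common irreducible quotient live at the same object, and come from
equivalent idempotents. -/
lemma idempotentEquiv_of_hasQuotient (R : GenReedy.{t} k C) {x : C}
    (hA : IsSemiperfectRing (R.A0 x)) {e f : R.A0 x} (he : IsPrimitiveIdempotent e)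
    (hf : IsPrimitiveIdempotent f) {S : LinRep k C} (hS : S.IsIrreducible)
    (heS : (R.standard x e).HasQuotient S) (hfS : (R.standard x f).HasQuotient S) :
    IdempotentEquiv e f := by
  obtain ⟨⟨s, hs0, hs⟩, hv, -⟩ := exists_ne_zero_of_hasQuotient R he.1 hS heS
  obtain ⟨⟨t, ht0, ht⟩, -, -⟩ := exists_ne_zero_of_hasQuotient R hf.1 hS hfS
  let := R.objModule S x
  -- Simplicity of `S` supplies an endomorphism of `x` from `p` to `q`; as `S` vanishes below `x`,
  -- an element of `A_x^0` acts in the same way.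
  have key : ∀ {p q : S.toFunctor.obj x}, p ≠ 0 → ∃ a : R.A0 x, a • p = q := by
    intro p q hp
    obtain ⟨g, hg⟩ := hS.exists_act_eq hp q
    obtain ⟨a, ha⟩ := hv.exists_act_eq g
    exact ⟨a, (ha p).symm.trans hg⟩
  exact he.idempotentEquiv hA hf hs ht ht0 (key ht0) (key hs0)

/-- The object is the unique point of minimal degree in the support of `S`. -/
lemma eq_of_hasQuotient (R : GenReedy.{t} k C) {x y : C} {e : R.A0 x} {f : R.A0 y}
    (he : IsIdempotentElem e) (hf : IsIdempotentElem f) {S : LinRep k C} (hS : S.IsIrreducible)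
    (heS : (R.standard x e).HasQuotient S) (hfS : (R.standard y f).HasQuotient S) : x = y := by
  obtain ⟨⟨s, hs0, -⟩, -, hx⟩ := exists_ne_zero_of_hasQuotient R he hS heS
  obtain ⟨⟨t, ht0, -⟩, -, hy⟩ := exists_ne_zero_of_hasQuotient R hf hS hfS
  rcases hx y ⟨t, 0, ht0⟩ with h | h
  · exact h
  rcases hy x ⟨s, 0, hs0⟩ with h' | h'
  · exact h'.symm
  · exact absurd h (lt_asymm h')

/-- Every irreducible representation is a quotient of a standard module. -/
lemma exists_hasQuotient (R : GenReedy.{t} k C) {E : ∀ x : C, Finset (R.A0 x)}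
    (hE : ∀ x, IsCompletePrimitiveSet (E x)) {S : LinRep k C} (hS : S.IsIrreducible) :
    ∃ x, ∃ e ∈ E x, (R.standard x e).HasQuotient S := by
  obtain ⟨x, hx, hmin⟩ := (InvImage.wf R.deg wellFounded_lt).has_min
    {x | Nontrivial (S.toFunctor.obj x)} hS.1
  have hv : R.VanishesBelow S x := fun z hz => by
    rw [← not_nontrivial_iff_subsingleton]
    exact fun h => hmin z h hz
  let := R.objModule S x
  have : Nontrivial (S.toFunctor.obj x) := hx
  obtain ⟨s, hs⟩ := exists_ne (0 : S.toFunctor.obj x)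
  -- The vector `e • s` is nonzero and fixed by `e`, so it defines a nonzero map from the standard
  -- module to `S`, which is onto by irreducibility.
  obtain ⟨e, he, hes⟩ := (hE x).exists_smul_ne_zero hs
  have hee : e • e • s = e • s := by rw [← mul_smul, ((hE x).2 e he).1.eq]
  obtain ⟨φ, hφ⟩ := R.exists_hom_standard e hv (m := e • s) hee
  exact ⟨x, e, he, φ, hS.surjective φ (m := R.standardGen x e) (by rw [hφ]; exact hes)⟩

end GenReedy

/-! ### The classification -/

/-- Two surjections with the same fibres have equivalent codomains. -/
lemma exists_equiv_of_surjective {P α β : Type*} (r : P → P → Prop) {f : P → α} {g : P → β}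
    (hf : Function.Surjective f) (hg : Function.Surjective g)
    (hfr : ∀ p q, f p = f q ↔ r p q) (hgr : ∀ p q, g p = g q ↔ r p q) :
    ∃ e : α ≃ β, ∀ p, e (f p) = g p := by
  choose s hs using hf
  have key : ∀ p, g (s (f p)) = g p := fun p => by rw [hgr, ← hfr, hs]
  refine ⟨Equiv.ofBijective (fun a => g (s a)) ⟨fun a b hab => ?_, fun b => ?_⟩, key⟩
  · have : f (s a) = f (s b) := by rw [hfr, ← hgr]; exact hab
    rwa [hs, hs] at this
  · obtain ⟨p, rfl⟩ := hg b
    exact ⟨f p, key p⟩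

namespace GenReedy

variable {k : Type w} [CommRing k] {C : Type u} [Category.{v} C] [Preadditive C] [Linear k C]

/-- Equivalence of idempotents at the same object. -/
def SigmaEquiv (R : GenReedy.{t} k C) (E : ∀ x : C, Finset (R.A0 x)) (p q : Σ x : C, E x) :
    Prop :=
  ∃ (x : C) (e f : E x), IdempotentEquiv e.1 f.1 ∧ p = ⟨x, e⟩ ∧ q = ⟨x, f⟩

variable {R : GenReedy.{t} k C} {E : ∀ x : C, Finset (R.A0 x)}

lemma simpleTop_cls_eq_iff (hA : ∀ x : C, IsSemiperfectRing (R.A0 x))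
    (hE : ∀ x, IsCompletePrimitiveSet (E x)) (p q : Σ x : C, E x) :
    (R.simpleTop p.2.1).cls = (R.simpleTop q.2.1).cls ↔ R.SigmaEquiv E p q := by
  obtain ⟨x, e, he⟩ := p
  obtain ⟨y, f, hf⟩ := q
  have hep := (hE x).2 e he
  have hfp := (hE y).2 f hf
  have hS := R.simpleTop_isIrreducible (hA y) hfp
  have hq : (R.standard y f).HasQuotient (R.simpleTop f) :=
    (R.hasQuotient_standard_iff (hA y) hfp hS).2 rfl
  change (R.simpleTop e).cls = (R.simpleTop f).cls ↔ _
  constructor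
  · intro h
    have hq' := (R.hasQuotient_standard_iff (hA x) hep hS).2 h
    obtain rfl := R.eq_of_hasQuotient hep.1 hfp.1 hS hq' hq
    have hef := R.idempotentEquiv_of_hasQuotient (hA x) hep hfp hS hq' hq
    exact ⟨x, ⟨e, he⟩, ⟨f, hf⟩, hef, rfl, rfl⟩
  · rintro ⟨z, e', f', h, h1, h2⟩
    cases h1
    cases h2
    obtain ⟨i⟩ := R.nonempty_standard_iso hep.1 hfp.1 h
    exact (R.hasQuotient_standard_iff (hA _) hep hS).1 (hq.of_iso_left i)

/-- Isomorphic standard modules share their simple quotient, which reduces the forward direction to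
`simpleTop_cls_eq_iff`. -/
lemma standard_cls_eq_iff (hA : ∀ x : C, IsSemiperfectRing (R.A0 x))
    (hE : ∀ x, IsCompletePrimitiveSet (E x)) (p q : Σ x : C, E x) :
    (R.standard p.1 p.2.1).cls = (R.standard q.1 q.2.1).cls ↔ R.SigmaEquiv E p q := by
  constructor
  · intro h
    obtain ⟨i⟩ := Quotient.exact h
    have hq := (hE q.1).2 q.2.1 q.2.2
    have hS := R.simpleTop_isIrreducible (hA q.1) hq
    rw [← simpleTop_cls_eq_iff hA hE,
      ← R.hasQuotient_standard_iff (hA p.1) ((hE p.1).2 p.2.1 p.2.2) hS]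
    exact ((R.hasQuotient_standard_iff (hA q.1) hq hS).2 rfl).of_iso_left i
  · rintro ⟨z, e, f, h, rfl, rfl⟩
    exact Quotient.sound
      (R.nonempty_standard_iso ((hE z).2 e.1 e.2).1 ((hE z).2 f.1 f.2).1 h)

/-- Isomorphic left ideals `A e` and `A f` have a common simple quotient, and this forces
equivalence of the idempotents. -/
lemma idempotent_class_eq_iff (hA : ∀ x : C, IsSemiperfectRing (R.A0 x))
    (hE : ∀ x, IsCompletePrimitiveSet (E x)) (p q : Σ x : C, E x) :
    (⟨p.1, Quotient.mk _ p.2⟩ : Σ x : C, Quotient (idempotentSetoid (E x))) =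
      ⟨q.1, Quotient.mk _ q.2⟩ ↔ R.SigmaEquiv E p q := by
  constructor
  · obtain ⟨x, e⟩ := p
    obtain ⟨y, f⟩ := q
    intro h
    obtain ⟨rfl, h⟩ := Sigma.mk.inj_iff.1 h
    obtain ⟨i⟩ := Quotient.exact (eq_of_heq h)
    have hf := (hE x).2 f.1 f.2
    obtain ⟨⟨L, hL⟩, hfL⟩ := exists_isLeftIdealTop hf.2.1
    exact ⟨x, e, f, ((hE x).2 e.1 e.2).idempotentEquiv_of_isLeftIdealTop (hA x) hf
      (hfL.of_linearEquiv i) hfL, rfl, rfl⟩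
  · rintro ⟨z, e, f, h, rfl, rfl⟩
    exact congrArg (Sigma.mk z) (Quotient.sound h.nonempty_linearEquiv)

/-- The class of the simple quotient of `A e`, for `e` in a complete set of primitive
idempotents. -/
def simpleModuleTop (hE : ∀ x, IsCompletePrimitiveSet (E x)) (p : Σ x : C, E x) :
    Σ x : C, SimpleModuleClass (R.A0 x) :=
  ⟨p.1, Quotient.mk _ (exists_isLeftIdealTop ((hE p.1).2 p.2.1 p.2.2).2.1).choose⟩

/-- Uniqueness of the simple quotient of `A e` makes the choice in `simpleModuleTop` immaterial. -/
lemma simpleModuleTop_eq_mk_iff (hA : ∀ x : C, IsSemiperfectRing (R.A0 x))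
    (hE : ∀ x, IsCompletePrimitiveSet (E x)) {x : C} (e : E x) (L : ModuleCat.{v} (R.A0 x))
    (hL : IsSimpleModule (R.A0 x) L) :
    simpleModuleTop hE ⟨x, e⟩ = ⟨x, Quotient.mk _ ⟨L, hL⟩⟩ ↔ IsLeftIdealTop e.1 L := by
  have he := (hE x).2 e.1 e.2
  have hM := (exists_isLeftIdealTop he.2.1).choose_spec
  have := (exists_isLeftIdealTop he.2.1).choose.2
  constructor
  · intro h
    obtain ⟨i⟩ := Quotient.exact (eq_of_heq (Sigma.mk.inj_iff.1 h).2)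
    obtain ⟨f, hf⟩ := hM
    exact ⟨i.toLinearMap.comp f, i.surjective.comp hf⟩
  · intro h
    exact congrArg (Sigma.mk x)
      (Quotient.sound (he.nonempty_equiv_of_isLeftIdealTop (hA x) hM h))

lemma simpleModuleTop_eq_iff (hA : ∀ x : C, IsSemiperfectRing (R.A0 x))
    (hE : ∀ x, IsCompletePrimitiveSet (E x)) (p q : Σ x : C, E x) :
    simpleModuleTop hE p = simpleModuleTop hE q ↔ R.SigmaEquiv E p q := by
  constructor
  · obtain ⟨x, e⟩ := p
    obtain ⟨y, f⟩ := q
    intro h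
    obtain rfl : x = y := congrArg Sigma.fst h
    have hf := (hE x).2 f.1 f.2
    have hM := (exists_isLeftIdealTop hf.2.1).choose_spec
    have hs := (exists_isLeftIdealTop hf.2.1).choose.2
    exact ⟨x, e, f, ((hE x).2 e.1 e.2).idempotentEquiv_of_isLeftIdealTop (hA x) hf
      ((simpleModuleTop_eq_mk_iff hA hE e _ hs).1 h) hM, rfl, rfl⟩
  · rintro ⟨z, e, f, h, rfl, rfl⟩
    obtain ⟨i⟩ := h.nonempty_linearEquiv
    have hf := (hE z).2 f.1 f.2
    have hM := (exists_isLeftIdealTop hf.2.1).choose_spec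
    have hs := (exists_isLeftIdealTop hf.2.1).choose.2
    exact (simpleModuleTop_eq_mk_iff hA hE e _ hs).2 (hM.of_linearEquiv i)

lemma simpleModuleTop_surjective (hA : ∀ x : C, IsSemiperfectRing (R.A0 x))
    (hE : ∀ x, IsCompletePrimitiveSet (E x)) : Function.Surjective (simpleModuleTop hE) := by
  rintro ⟨x, ⟨L, hL⟩⟩
  have := hL.nontrivial
  obtain ⟨l, hl⟩ := exists_ne (0 : L)
  obtain ⟨e, he, hel⟩ := (hE x).exists_smul_ne_zero hl
  have hidem := ((hE x).2 e he).1
  exact ⟨⟨x, e, he⟩, (simpleModuleTop_eq_mk_iff hA hE ⟨e, he⟩ L hL).2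
    ((isLeftIdealTop_iff hidem).2 ⟨e • l, hel, by rw [← mul_smul, hidem.eq]⟩)⟩

end GenReedy

end

theorem theoremB {k : Type w} [CommRing k] {C : Type u} [Category.{v} C] [Preadditive C]
    [Linear k C] (R : GenReedy.{t} k C)
    (hplus : R.PlusRightProjective) (hminus : R.MinusLeftProjective)
    (hA : ∀ x : C, IsSemiperfectRing (R.A0 x)) :
    (∀ x : C, ∃ E : Finset (R.A0 x), IsCompletePrimitiveSet E) ∧
    ∀ E : ∀ x : C, Finset (R.A0 x), (∀ x, IsCompletePrimitiveSet (E x)) →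
      (∀ (x : C) (e : R.A0 x), e ∈ E x → (R.standard x e).IsIndecomposable) ∧
      ∃ (Φ : R.standardClasses E ≃ LinRep.irreducibleClasses k C)
        (Χ : R.standardClasses E ≃ (Σ x : C, Quotient (idempotentSetoid (E x))))
        (Ψ : R.standardClasses E ≃ (Σ x : C, SimpleModuleClass (R.A0 x))),
        (∀ (x : C) (e : R.A0 x) (he : e ∈ E x) (S : LinRep k C) (hS : S.IsIrreducible),
          Φ ⟨(R.standard x e).cls, x, e, he, rfl⟩ = ⟨S.cls, S, hS, rfl⟩ ↔
            (R.standard x e).HasQuotient S) ∧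
        (∀ (x : C) (e : R.A0 x) (he : e ∈ E x),
          Χ ⟨(R.standard x e).cls, x, e, he, rfl⟩ = ⟨x, Quotient.mk _ ⟨e, he⟩⟩) ∧
        (∀ (x : C) (e : R.A0 x) (he : e ∈ E x) (L : ModuleCat.{v} (R.A0 x))
          (hL : IsSimpleModule (R.A0 x) L),
          Ψ ⟨(R.standard x e).cls, x, e, he, rfl⟩ = ⟨x, Quotient.mk _ ⟨L, hL⟩⟩ ↔
            ∃ f : (Ideal.span {e} : Ideal (R.A0 x)) →ₗ[R.A0 x] L, Function.Surjective f) := by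
  refine ⟨fun x => (hA x).exists_isCompletePrimitiveSet, fun E hE =>
    ⟨fun x e he => R.standard_isIndecomposable (hA x) ((hE x).2 e he), ?_⟩⟩
  -- Each of the four sets is presented as the image of the pairs `(x, e)`, with fibres given by
  -- `SigmaEquiv`.
  let std : (Σ x : C, E x) → R.standardClasses E := fun p =>
    ⟨(R.standard p.1 p.2.1).cls, p.1, p.2.1, p.2.2, rfl⟩
  have hstd : Function.Surjective std := by
    rintro ⟨_, x, e, he, rfl⟩
    exact ⟨⟨x, e, he⟩, rfl⟩
  have hstdr : ∀ p q, std p = std q ↔ R.SigmaEquiv E p q := fun p q =>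
    Subtype.ext_iff.trans (GenReedy.standard_cls_eq_iff hA hE p q)
  let irr : (Σ x : C, E x) → LinRep.irreducibleClasses k C := fun p =>
    ⟨(R.simpleTop p.2.1).cls, _,
      R.simpleTop_isIrreducible (hA p.1) ((hE p.1).2 p.2.1 p.2.2), rfl⟩
  have hirr : Function.Surjective irr := by
    rintro ⟨_, S, hS, rfl⟩
    obtain ⟨x, e, he, h⟩ := R.exists_hasQuotient hE hS
    exact ⟨⟨x, e, he⟩,
      Subtype.ext ((R.hasQuotient_standard_iff (hA x) ((hE x).2 e he) hS).1 h)⟩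
  obtain ⟨Φ, hΦ⟩ := exists_equiv_of_surjective (R.SigmaEquiv E) hstd hirr hstdr fun p q =>
    Subtype.ext_iff.trans (GenReedy.simpleTop_cls_eq_iff hA hE p q)
  obtain ⟨Χ, hΧ⟩ := exists_equiv_of_surjective (R.SigmaEquiv E) hstd
    (g := fun p => (⟨p.1, Quotient.mk _ p.2⟩ : Σ x : C, Quotient (idempotentSetoid (E x))))
    (by rintro ⟨x, ⟨e⟩⟩; exact ⟨⟨x, e⟩, rfl⟩) hstdr (GenReedy.idempotent_class_eq_iff hA hE)
  obtain ⟨Ψ, hΨ⟩ := exists_equiv_of_surjective (R.SigmaEquiv E) hstd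
    (GenReedy.simpleModuleTop_surjective hA hE) hstdr (GenReedy.simpleModuleTop_eq_iff hA hE)
  refine ⟨Φ, Χ, Ψ, fun x e he S hS => ?_, fun x e he => hΧ ⟨x, e, he⟩, fun x e he L hL => ?_⟩
  · rw [R.hasQuotient_standard_iff (hA x) ((hE x).2 e he) hS]
    exact (Eq.congr_left (hΦ ⟨x, e, he⟩)).trans Subtype.ext_iff
  · exact (Eq.congr_left (hΨ ⟨x, e, he⟩)).trans
      (GenReedy.simpleModuleTop_eq_mk_iff hA hE ⟨e, he⟩ L hL)
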